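/- Let $\lambda>0$, $\rho>0$ and $-\lambda\le\beta\le\frac{\lambda}{e^{\rho}-1}$. Consider an $M|G|\infty$ queue, empty at time $0$: customers arrive according to a Poisson process of rate $\lambda$, there are infinitely many servers, and the service times are independent of each other and of the arrivals, with the distribution function $$G(t)=1-\frac{(1-e^{-\rho})(\lambda+\beta)}{\lambda e^{-\rho}\left(e^{(\lambda+\beta)t}-1\right)+\lambda},\quad t\ge 0,\qquad G(t)=0,\quad t<0 .$$ The busy cycle is the idle period up to the first arrival, followed by the busy period, which lasts from that arrival until the system is first empty (it has length $0$ if the opening service has length $0$). Let $Z^{(\beta)}$ be the distribution function of the length of the busy cycle, which is a random variable. 1. If $\beta\neq\lambda(e^{\rho}-1)$, then for all $t\ge 0$ $$Z^{(\beta)}(t)=1-\frac{(1-e^{-\rho})(\lambda+\beta)}{\lambda-e^{-\rho}(\lambda+\beta)}\,e^{-e^{-\rho}(\lambda+\beta)t}+\frac{\beta}{\lambda-e^{-\rho}(\lambda+\beta)}\,e^{-\lambda t}.$$ If $\beta=\lambda(e^{\rho}-1)$, where the denominators vanish, then $Z^{(\beta)}(t)=1-(1+\beta t)e^{-\lambda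 t}$ for all $t\ge0$. 2. If $\beta>-\lambda$ and $\beta\ne\lambda(e^{\rho}-1)$, then $Z^{(\beta)}$ is a mixture of two exponential distributions in the sense that $Z^{(\beta)}=w\,F_{\mu}+(1-w)\,F_{\lambda}$, where $F_r$ is the exponential distribution function with rate $r$, $\mu=e^{-\rho}(\lambda+\beta)$ and $w=\frac{(1-e^{-\rho})(\lambda+\beta)}{\lambda-e^{-\rho}(\lambda+\beta)}$. Both weights are nonnegative if and only if $\beta\le 0$. 3. If $\beta=-\lambda$, then $G(t)=1$ and $Z^{(-\lambda)}(t)=1-e^{-\lambda t}$ for all $t\ge 0$, that is, the busy cycle length is exponential with parameter $\lambda$. 4. If $\beta=\frac{\lambda}{e^{\rho}-1}$ and $\rho\ne\ln 2$, then for all $t\ge 0$ $$Z^{(\beta)}(t)=1-\frac{(e^{\rho}-1)e^{-\frac{\lambda}{e^{\rho}-1}t}-e^{-\lambda t}}{e^{\rho}-2}.$$ For every $t\ge0$ the right-hand side tends to $1-(1+\lambda t)e^{-\lambda t}$ as $\rho\to\ln 2$, and this limit is the value of $Z^{(\beta)}(t)$ for $\rho=\ln 2$, $\beta=\frac{\lambda}{e^{\rho}-1}=\lambda$.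 -/

import Mathlib

open MeasureTheory ProbabilityTheory Filter Topology

noncomputable section

namespace MGInfinity

variable {Ω : Type*}

/-- Epoch of the arrival of customer `n` (customers are numbered from `0`), when the system is
empty at time `0`, customer `0` arrives at time `T 0`, and `T (n + 1)` is the time between the
arrivals of customers `n` and `n + 1`. -/
def arrivalTime (T : ℕ → Ω → ℝ) (n : ℕ) (ω : Ω) : ℝ :=
  ∑ i ∈ Finset.range (n + 1), T i ω

/-- Number of customers being served at time `t`. There is always a free server, so customer `n`
is served during `[arrivalTime n, arrivalTime n + S n)`. -/
def numberInSystem (T S : ℕ → Ω → ℝ) (t : ℝ) (ω : Ω) : ℕ∞ :=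
  {n : ℕ | arrivalTime T n ω ≤ t ∧ t < arrivalTime T n ω + S n ω}.encard

/-- Length of the first idle period, which starts at time `0` and ends with the first arrival. -/
def idlePeriod (T : ℕ → Ω → ℝ) (ω : Ω) : ℝ :=
  arrivalTime T 0 ω

/-- Length of the first busy period: the time from the first arrival until the system is empty.
It is `⊤` if the system never becomes empty again, and `0` if the service that opens
it has length `0`. -/
def busyPeriod (T S : ℕ → Ω → ℝ) (ω : Ω) : EReal :=
  sInf ((fun u : ℝ => (u : EReal)) ''
    {u : ℝ | 0 ≤ u ∧ numberInSystem T S (idlePeriod T ω + u) ω = 0})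

/-- Length of the first busy cycle: an idle period followed by a busy period. -/
def busyCycle (T S : ℕ → Ω → ℝ) (ω : Ω) : EReal :=
  (idlePeriod T ω : EReal) + busyPeriod T S ω

/-- `T` and `S` drive an `M|G|∞` queue that is empty at time `0`: arrivals form a Poisson process
of rate `lam` (independent exponential interarrival times), the service times are independent with
distribution function `G`, and they are independent of the arrivals. -/
structure IsQueue [MeasurableSpace Ω] (P : Measure Ω) (lam : ℝ) (G : ℝ → ℝ)
    (T S : ℕ → Ω → ℝ) : Prop where
  measurable_interarrival : ∀ n, Measurable (T n)
  measurable_service : ∀ n, Measurable (S n)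
  law_interarrival : ∀ n, P.map (T n) = expMeasure lam
  law_service : ∀ (n : ℕ) (t : ℝ), P.real {ω | S n ω ≤ t} = G t
  indep : iIndepFun (Sum.elim T S : ℕ ⊕ ℕ → Ω → ℝ) P

/-- The service distribution function with parameters `lam`, `rho`, `beta`; it vanishes on the
negative half-line. -/
def serviceCDF (lam rho beta t : ℝ) : ℝ :=
  if t < 0 then 0 else
    1 - (1 - Real.exp (-rho)) * (lam + beta) /
      (lam * Real.exp (-rho) * (Real.exp ((lam + beta) * t) - 1) + lam)

/-- Distribution function of the length of the first busy cycle. -/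
def busyCycleCDF [MeasurableSpace Ω] (P : Measure Ω) (T S : ℕ → Ω → ℝ) (t : ℝ) : ℝ :=
  P.real {ω | busyCycle T S ω ≤ (t : EReal)}

end MGInfinity

end

/-! Put `q = exp (-rho)` and `a = lam + beta`. Immediately after an arrival the system matters only
through the residual time `x`, the time until everyone now present has left. The next interarrival
time `X` either exceeds `x`, and the system empties, or the residual time becomes `max (x - X) Y`
with a fresh service time `Y`. The residual times thus form a Markov chain, and the Laplace
transform `φ` of the time to emptiness should satisfy `φ(x) = E[exp(-s x); X > x] + E[exp(-s X)
φ(max (x - X) Y); X ≤ x]`.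

For the given service law this equation has the explicit solution `residualTransform`, a combination
of `exp(-s x)` and `exp(-(s + a) x)`. The reason is that `φ'(x)` contains exactly the factor `q
(exp(a x) - 1) + 1` in the denominator of the service tail, so `φ'` times the tail is a pure
exponential (`integral_residualTransform_max`, `integral_stepTransform`).

Consequently the discounted value of `φ` along the chain, plus what has been collected at the end of
the cycle, has constant expectation (`integral_discount_succ`). The discounted value tends to `0` in
mean, because `E exp(-s A_n) = (lam / (s + lam)) ^ (n + 1)` for the arrival epochs `A_n`. Hence the
cycle has transform `1 - s (s + a) / ((s + q a) (s + lam))`, at first only on the event that some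
gap ends the busy period; letting `s → 0` shows that this event is almost sure (`ae_exists_gap`).

The formulas follow by partial fractions and uniqueness of Laplace transforms, for affine
combinations whose weights may be negative (`measureReal_eq_of_laplace_eq`). Poles at `-q a` and
`-lam` give two exponential laws; when `q a = lam` the double pole brings in a gamma law of shape
`2`. -/

noncomputable section

/-! ### The one-step equation for the residual-time transform. -/

namespace MGInfinity

/-- The Laplace transform at `s` of the time until the system is empty, as a function of the time
`x` until the present customers have left. -/
def residualTransform (q a s x : ℝ) : ℝ :=
  ((s + a) * q * Real.exp (-(s * x)) + s * (1 - q) * Real.exp (-((s + a) * x))) / (s + q * a)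

/-- The derivative of `residualTransform`. -/
def residualTransformDeriv (q a s x : ℝ) : ℝ :=
  -(s * (s + a) / (s + q * a)) * (q * Real.exp (-(s * x)) + (1 - q) * Real.exp (-((s + a) * x)))

lemma hasDerivAt_exp_neg_mul (c x : ℝ) :
    HasDerivAt (fun x => Real.exp (-(c * x))) (-c * Real.exp (-(c * x))) x := by
  have h : HasDerivAt (fun x : ℝ => -(c * x)) (-c) x := by
    convert! (hasDerivAt_id x).const_mul (-c) using 1
    · ext y; simp
    · simp
  simpa [mul_comm] using h.exp

lemma hasDerivAt_residualTransform (q a s x : ℝ) :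
    HasDerivAt (residualTransform q a s) (residualTransformDeriv q a s x) x := by
  have h := (((hasDerivAt_exp_neg_mul s x).const_mul ((s + a) * q)).add
    ((hasDerivAt_exp_neg_mul (s + a) x).const_mul (s * (1 - q)))).div_const (s + q * a)
  convert! h using 1
  unfold residualTransformDeriv
  ring

@[fun_prop]
lemma continuous_residualTransform (q a s : ℝ) : Continuous (residualTransform q a s) := by
  unfold residualTransform; fun_prop

@[fun_prop]
lemma continuous_residualTransformDeriv (q a s : ℝ) :
    Continuous (residualTransformDeriv q a s) := by
  unfold residualTransformDeriv; fun_prop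

section
variable {q a s : ℝ}

lemma residualTransform_zero (h : s + q * a ≠ 0) : residualTransform q a s 0 = 1 := by
  simp only [residualTransform, mul_zero, neg_zero, Real.exp_zero]
  rw [div_eq_one_iff_eq h]; ring

lemma residualTransform_nonneg (hq : 0 ≤ q) (hq1 : q ≤ 1) (ha : 0 ≤ a) (hs : 0 < s) (x : ℝ) :
    0 ≤ residualTransform q a s x := by
  have : 0 ≤ 1 - q := by linarith
  unfold residualTransform; positivity

lemma residualTransform_le_one (hq : 0 ≤ q) (hq1 : q ≤ 1) (ha : 0 ≤ a) (hs : 0 < s) {x : ℝ}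
    (hx : 0 ≤ x) : residualTransform q a s x ≤ 1 := by
  have h1 : 0 ≤ 1 - q := by linarith
  have hpos : 0 < s + q * a := by positivity
  have e1 : Real.exp (-(s * x)) ≤ 1 := Real.exp_le_one_iff.2 (by nlinarith)
  have e2 : Real.exp (-((s + a) * x)) ≤ 1 := Real.exp_le_one_iff.2 (by
    have : 0 ≤ (s + a) * x := by positivity
    linarith)
  unfold residualTransform
  rw [div_le_one hpos]
  have i1 : (s + a) * q * Real.exp (-(s * x)) ≤ (s + a) * q * 1 := by gcongr
  have i2 : s * (1 - q) * Real.exp (-((s + a) * x)) ≤ s * (1 - q) * 1 := by gcongr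
  linarith

lemma integrableOn_exp_neg_mul {c : ℝ} (hc : 0 < c) (r : ℝ) :
    IntegrableOn (fun x => Real.exp (-(c * x))) (Set.Ioi r) := by
  simpa only [neg_mul] using exp_neg_integrableOn_Ioi r hc

lemma setIntegral_exp_neg_mul {c : ℝ} (hc : 0 < c) (r : ℝ) :
    ∫ x in Set.Ioi r, Real.exp (-(c * x)) = Real.exp (-(c * r)) / c := by
  have := integral_exp_mul_Ioi (a := -c) (by linarith) r
  simp only [neg_mul] at this
  rw [this, neg_div_neg_eq]

lemma integrableOn_residualTransformDeriv (ha : 0 ≤ a) (hs : 0 < s) (r : ℝ) :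
    IntegrableOn (residualTransformDeriv q a s) (Set.Ioi r) := by
  unfold residualTransformDeriv
  exact (((integrableOn_exp_neg_mul hs r).const_mul _).add
    ((integrableOn_exp_neg_mul (by linarith : 0 < s + a) r).const_mul _)).const_mul _

/-- The fundamental theorem of calculus on `[r, max r y]`. The indicator keeps the domain
independent of `y`, so that Fubini applies when `y` is integrated. -/
lemma residualTransform_max_eq (r y : ℝ) :
    residualTransform q a s (max r y) = residualTransform q a s r +
      ∫ x in Set.Ioi r, (Set.Iio y).indicator (residualTransformDeriv q a s) x := by
  have h : ∫ x in Set.Ioi r, (Set.Iio y).indicator (residualTransformDeriv q a s) x =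
      ∫ x in r..(max r y), residualTransformDeriv q a s x := by
    rw [intervalIntegral.integral_of_le (le_max_left _ _), integral_Ioc_eq_integral_Ioo,
      setIntegral_indicator measurableSet_Iio]
    rcases le_total r y with hr | hr
    · rw [max_eq_right hr]; rfl
    · rw [max_eq_left hr, Set.Ioi_inter_Iio, Set.Ioo_eq_empty (not_lt.2 hr), Set.Ioo_eq_empty (lt_irrefl r)]
  rw [h, intervalIntegral.integral_eq_sub_of_hasDerivAt
    (fun x _ => hasDerivAt_residualTransform q a s x)
    ((continuous_residualTransformDeriv q a s).intervalIntegrable _ _)]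
  ring

/-- By Fubini, `E φ(max r Y) = φ(r) + ∫_r^∞ φ'(x) P(Y > x) dx`. The integrand is a multiple of
`exp(-(s + a) x)`, and the integrated exponential is a linear combination of `φ(r)` and `φ'(r)`. -/
lemma integral_residualTransform_max (ν : Measure ℝ) [IsProbabilityMeasure ν]
    {lam : ℝ} (hlam : 0 < lam) (hq : 0 < q) (ha : 0 ≤ a) (hs : 0 < s)
    (hν : ∀ x, 0 ≤ x → ν.real (Set.Ioi x) =
      (1 - q) * a / (lam * q * (Real.exp (a * x) - 1) + lam)) {r : ℝ} (hr : 0 ≤ r) :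
    ∫ y, residualTransform q a s (max r y) ∂ν =
      ((lam + s) * residualTransform q a s r + residualTransformDeriv q a s r) / lam := by
  have hpos : 0 < s + q * a := by positivity
  set d := residualTransformDeriv q a s with hd
  have hint : Integrable (Function.uncurry fun (y x : ℝ) => (Set.Iio y).indicator d x)
      (ν.prod (volume.restrict (Set.Ioi r))) := by
    have h0 : Integrable (fun p : ℝ × ℝ => d p.2) (ν.prod (volume.restrict (Set.Ioi r))) :=
      (integrableOn_residualTransformDeriv ha hs r).comp_snd ν
    have hm : MeasurableSet {p : ℝ × ℝ | p.2 < p.1} := measurableSet_lt measurable_snd measurable_fst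
    convert! h0.indicator hm using 1
  have hint1 : Integrable (fun y => ∫ x in Set.Ioi r, (Set.Iio y).indicator d x) ν :=
    hint.integral_prod_left
  simp_rw [residualTransform_max_eq]
  rw [integral_add (integrable_const _) hint1, integral_integral_swap hint, integral_const]
  -- The cancellation that singles out this service law: `q exp(-s x) + (1 - q) exp(-(s + a) x)`
  -- equals `exp(-(s + a) x) (q (exp(a x) - 1) + 1)`, and the last factor is the tail's denominator
  -- divided by `lam`.
  have hswap : ∀ x ∈ Set.Ioi r, ∫ y, (Set.Iio y).indicator d x ∂ν =
      -(s * (s + a) * (1 - q) * a / (lam * (s + q * a))) * Real.exp (-((s + a) * x)) := by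
    intro x hx
    have h1 : (fun y => (Set.Iio y).indicator d x) = (Set.Ioi x).indicator fun _ => d x := by
      ext y; simp [Set.indicator_apply]
    rw [h1, integral_indicator_const _ measurableSet_Ioi, hν x (hr.trans (le_of_lt hx)), hd,
      residualTransformDeriv, smul_eq_mul]
    have e1 : Real.exp (-((s + a) * x)) = Real.exp (-(s * x)) * (Real.exp (a * x))⁻¹ := by
      rw [← Real.exp_neg, ← Real.exp_add]; congr 1; ring
    rw [e1]
    have e2 : 1 ≤ Real.exp (a * x) := Real.one_le_exp (mul_nonneg ha (hr.trans (le_of_lt hx)))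
    have e3 : 0 < lam * q * (Real.exp (a * x) - 1) + lam := by
      have : 0 ≤ lam * q * (Real.exp (a * x) - 1) := by
        have : 0 ≤ Real.exp (a * x) - 1 := by linarith
        positivity
      linarith
    have e4 : 0 < q * (Real.exp (a * x) - 1) + 1 := by
      have : lam * q * (Real.exp (a * x) - 1) + lam = lam * (q * (Real.exp (a * x) - 1) + 1) := by
        ring
      rw [this] at e3
      exact (mul_pos_iff_of_pos_left hlam).1 e3
    have e5 := Real.exp_pos (a * x)
    generalize Real.exp (a * x) = E at *
    generalize Real.exp (-(s * x)) = F at *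
    rw [show lam * q * (E - 1) + lam = lam * (q * (E - 1) + 1) by ring]
    field_simp
    ring
  rw [setIntegral_congr_fun measurableSet_Ioi hswap, integral_const_mul,
    setIntegral_exp_neg_mul (by linarith), hd, residualTransformDeriv, residualTransform]
  have : s + a ≠ 0 := by positivity
  simp only [probReal_univ, one_smul]
  field_simp
  ring

lemma integral_expMeasure {lam : ℝ} (hlam : 0 < lam) (f : ℝ → ℝ) :
    ∫ x, f x ∂(expMeasure lam) = ∫ x in Set.Ioi 0, lam * Real.exp (-(lam * x)) * f x := by
  have h : expMeasure lam =
      volume.withDensity fun x => ENNReal.ofReal (exponentialPDFReal lam x) := rfl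
  rw [h, integral_withDensity_eq_integral_toReal_smul
    (measurable_exponentialPDFReal lam).ennreal_ofReal (by simp),
    ← integral_Ici_eq_integral_Ioi, ← integral_indicator measurableSet_Ici]
  congr 1; ext x
  rw [← exponentialPDF, exponentialPDF_eq]
  by_cases hx : 0 ≤ x
  · simp [hx, ENNReal.toReal_ofReal, hlam.le, Real.exp_nonneg]
  · simp [hx]

/-- One step of the Markov chain of residual times: either the system empties before the next
arrival, or the next customer is admitted. -/
def stepTransform (q a s v x y : ℝ) : ℝ :=
  if v < x then Real.exp (-(s * v)) else Real.exp (-(s * x)) * residualTransform q a s (max (v - x) y)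

/-- Split at `x = v`. For `x ≤ v` the integrand, after averaging over the service time, is the exact
derivative of `-exp(-(lam + s) x) φ(v - x)`. It contributes `φ(v) - exp(-(lam + s) v)`, as `φ(0) =
1`, and the part `x > v` restores the subtracted term. -/
lemma integral_stepTransform (ν : Measure ℝ) [IsProbabilityMeasure ν]
    {lam : ℝ} (hlam : 0 < lam) (hq : 0 < q) (ha : 0 ≤ a) (hs : 0 < s)
    (hν : ∀ x, 0 ≤ x → ν.real (Set.Ioi x) =
      (1 - q) * a / (lam * q * (Real.exp (a * x) - 1) + lam)) {v : ℝ} (hv : 0 ≤ v) :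
    ∫ x, ∫ y, stepTransform q a s v x y ∂ν ∂(expMeasure lam) = residualTransform q a s v := by
  rw [integral_expMeasure hlam, ← Set.Ioc_union_Ioi_eq_Ioi hv]
  have h1 : ∀ x ∈ Set.Ioc 0 v, lam * Real.exp (-(lam * x)) * ∫ y, stepTransform q a s v x y ∂ν =
      Real.exp (-((lam + s) * x)) * ((lam + s) * residualTransform q a s (v - x) +
        residualTransformDeriv q a s (v - x)) := by
    intro x hx
    simp only [stepTransform, if_neg (not_lt.2 hx.2)]
    rw [integral_const_mul, integral_residualTransform_max ν hlam hq ha hs hν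
      (sub_nonneg.2 hx.2), show -((lam + s) * x) = -(lam * x) + -(s * x) by ring, Real.exp_add]
    field_simp
  have h2 : ∀ x ∈ Set.Ioi v, lam * Real.exp (-(lam * x)) * ∫ y, stepTransform q a s v x y ∂ν =
      lam * Real.exp (-(s * v)) * Real.exp (-(lam * x)) := by
    intro x hx
    simp only [stepTransform, if_pos (Set.mem_Ioi.1 hx)]
    simp; ring
  have hcont : Continuous fun x => Real.exp (-((lam + s) * x)) *
      ((lam + s) * residualTransform q a s (v - x) + residualTransformDeriv q a s (v - x)) := by
    fun_prop
  rw [setIntegral_union (Set.Ioc_disjoint_Ioi le_rfl) measurableSet_Ioi,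
    setIntegral_congr_fun measurableSet_Ioc h1, setIntegral_congr_fun measurableSet_Ioi h2,
    integral_const_mul, setIntegral_exp_neg_mul hlam, ← intervalIntegral.integral_of_le hv]
  · rw [intervalIntegral.integral_eq_sub_of_hasDerivAt
      (f := fun x => -(Real.exp (-((lam + s) * x)) * residualTransform q a s (v - x))) _
      (hcont.intervalIntegrable _ _)]
    · have : s + q * a ≠ 0 := by positivity
      simp only [sub_self, residualTransform_zero this, mul_zero, neg_zero, Real.exp_zero, sub_zero]
      rw [show -((lam + s) * v) = -(lam * v) + -(s * v) by ring, Real.exp_add]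
      field_simp
      ring
    · intro x _
      have hb : HasDerivAt (fun x => residualTransform q a s (v - x))
          (-residualTransformDeriv q a s (v - x)) x := by
        simpa using (hasDerivAt_residualTransform q a s (v - x)).comp_const_sub v x
      convert! ((hasDerivAt_exp_neg_mul (lam + s) x).mul hb).neg using 1
      ring
  · exact (integrableOn_congr_fun h1 measurableSet_Ioc).2
      (hcont.integrableOn_Icc.mono_set Set.Ioc_subset_Icc_self)
  · exact (integrableOn_congr_fun h2 measurableSet_Ioi).2
      ((integrableOn_exp_neg_mul hlam v).const_mul _)

end

end MGInfinity

end

/-! ### Uniqueness of Laplace transforms, and the exponential and gamma laws. -/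

noncomputable section

namespace MGInfinity

/-- A bounded injective continuous function that equals `exp (-x)` on the nonnegative half-line. -/
def expNegExtension : BoundedContinuousFunction ℝ ℝ :=
  BoundedContinuousFunction.ofNormedAddCommGroup
    (fun x => Real.exp (-max x 0) + (1 - Real.exp (min x 0))) (by fun_prop) 2 (by
      intro x
      have h1 : Real.exp (-max x 0) ≤ 1 := Real.exp_le_one_iff.2 (by simp)
      have h2 : Real.exp (min x 0) ≤ 1 := Real.exp_le_one_iff.2 (by simp)
      have h3 := Real.exp_pos (-max x 0)
      have h4 := Real.exp_pos (min x 0)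
      rw [Real.norm_eq_abs, abs_le]
      constructor <;> linarith)

lemma expNegExtension_apply (x : ℝ) :
    expNegExtension x = Real.exp (-max x 0) + (1 - Real.exp (min x 0)) := rfl

lemma expNegExtension_of_nonneg {x : ℝ} (hx : 0 ≤ x) : expNegExtension x = Real.exp (-x) := by
  simp [expNegExtension_apply, hx]

lemma expNegExtension_strictAnti : StrictAnti expNegExtension := by
  intro x y hxy
  rw [expNegExtension_apply, expNegExtension_apply]
  have h1 : Real.exp (-max y 0) ≤ Real.exp (-max x 0) :=
    Real.exp_le_exp.2 (neg_le_neg (max_le_max_right 0 hxy.le))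
  have h2 : Real.exp (min x 0) ≤ Real.exp (min y 0) :=
    Real.exp_le_exp.2 (min_le_min_right 0 hxy.le)
  rcases lt_or_ge x 0 with hx | hx
  · have : Real.exp (min x 0) < Real.exp (min y 0) :=
      Real.exp_lt_exp.2 (by rw [min_eq_left hx.le]; exact lt_min hxy hx)
    linarith
  · have : Real.exp (-max y 0) < Real.exp (-max x 0) :=
      Real.exp_lt_exp.2 (by rw [max_eq_left hx, max_eq_left (hx.trans hxy.le)]; linarith)
    linarith

/-- The polynomials in `expNegExtension`. -/
def expNegPolynomials : StarSubalgebra ℝ (BoundedContinuousFunction ℝ ℝ) where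
  toSubalgebra := (Polynomial.aeval (R := ℝ) expNegExtension).range
  star_mem' := by
    intro f hf
    have : star f = f := by ext x; simp
    simpa only [this] using hf

lemma integrable_exp_neg_mul_of_nonneg {μ : Measure ℝ} [IsFiniteMeasure μ]
    (hμ : ∀ᵐ x ∂μ, 0 ≤ x) {s : ℝ} (hs : 0 ≤ s) :
    Integrable (fun x => Real.exp (-(s * x))) μ := by
  refine Integrable.of_bound (by fun_prop) 1 ?_
  filter_upwards [hμ] with x hx
  rw [Real.norm_eq_abs, abs_of_pos (Real.exp_pos _)]
  exact Real.exp_le_one_iff.2 (by nlinarith)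

/-- A finite measure on the nonnegative half-line is determined by its mass and its Laplace
transform. -/
lemma ext_of_laplace_eq {μ ν : Measure ℝ} [IsFiniteMeasure μ] [IsFiniteMeasure ν]
    (hμ : ∀ᵐ x ∂μ, 0 ≤ x) (hν : ∀ᵐ x ∂ν, 0 ≤ x)
    (h : ∀ s : ℝ, 0 ≤ s → ∫ x, Real.exp (-(s * x)) ∂μ = ∫ x, Real.exp (-(s * x)) ∂ν) :
    μ = ν := by
  -- A point-separating algebra of bounded continuous functions determines a finite measure. One
  -- injective function separates points, and on the half-line its polynomials are combinations of
  -- `exp(-i x)`, so transforms at natural numbers suffice.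
  refine ext_of_forall_mem_subalgebra_integral_eq_of_polish (𝕜 := ℝ) (A := expNegPolynomials) ?_ ?_
  · intro x y hxy
    refine ⟨expNegExtension, ⟨_, ⟨expNegExtension, ⟨Polynomial.X, by simp⟩, rfl⟩, rfl⟩, ?_⟩
    exact fun hf => hxy (expNegExtension_strictAnti.injective hf)
  · rintro g ⟨p, rfl⟩
    have key : ∀ {m : Measure ℝ} [IsFiniteMeasure m], (∀ᵐ x ∂m, 0 ≤ x) →
        ∫ x, (Polynomial.aeval expNegExtension p) x ∂m =
          ∑ i ∈ p.support, p.coeff i * ∫ x, Real.exp (-((i : ℝ) * x)) ∂m := by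
      intro m _ hm
      have h1 : ∀ᵐ x ∂m, (Polynomial.aeval expNegExtension p) x =
          ∑ i ∈ p.support, p.coeff i * Real.exp (-((i : ℝ) * x)) := by
        filter_upwards [hm] with x hx
        rw [Polynomial.aeval_eq_sum_range, BoundedContinuousFunction.coe_sum, Finset.sum_apply]
        symm
        refine Finset.sum_subset_zero_on_sdiff
          (fun i hi => Finset.mem_range_succ_iff.2 (Polynomial.le_natDegree_of_mem_supp i hi)) ?_ ?_
        · intro i hi
          have : p.coeff i = 0 := by simpa using (Finset.mem_sdiff.1 hi).2
          simp [this]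
        · intro i _
          simp only [BoundedContinuousFunction.coe_smul, BoundedContinuousFunction.coe_pow,
            Pi.pow_apply, smul_eq_mul, expNegExtension_of_nonneg hx, ← Real.exp_nat_mul]
          rw [mul_neg]
      rw [integral_congr_ae h1, integral_finsetSum]
      · simp_rw [integral_const_mul]
      · exact fun i _ => (integrable_exp_neg_mul_of_nonneg hm (Nat.cast_nonneg i)).const_mul _
    refine (key hμ).trans (Eq.trans ?_ (key hν).symm)
    exact Finset.sum_congr rfl fun i _ => by rw [h i (Nat.cast_nonneg i)]

/-- A distribution on the nonnegative half-line whose Laplace transform is an affine (not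
necessarily convex) combination of two Laplace transforms is the same combination of the two
distributions. -/
lemma measureReal_eq_of_laplace_eq {μ μ₁ μ₂ : Measure ℝ} [IsProbabilityMeasure μ]
    [IsProbabilityMeasure μ₁] [IsProbabilityMeasure μ₂]
    (hμ : ∀ᵐ x ∂μ, 0 ≤ x) (hμ₁ : ∀ᵐ x ∂μ₁, 0 ≤ x) (hμ₂ : ∀ᵐ x ∂μ₂, 0 ≤ x) (w : ℝ)
    (h : ∀ s : ℝ, 0 < s → ∫ x, Real.exp (-(s * x)) ∂μ =
      w * ∫ x, Real.exp (-(s * x)) ∂μ₁ + (1 - w) * ∫ x, Real.exp (-(s * x)) ∂μ₂) (A : Set ℝ) :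
    μ.real A = w * μ₁.real A + (1 - w) * μ₂.real A := by
  have h' : ∀ s : ℝ, 0 ≤ s → ∫ x, Real.exp (-(s * x)) ∂μ =
      w * ∫ x, Real.exp (-(s * x)) ∂μ₁ + (1 - w) * ∫ x, Real.exp (-(s * x)) ∂μ₂ := by
    intro s hs
    rcases hs.eq_or_lt with rfl | hs
    · simp
    · exact h s hs
  have hdecomp : ∀ x : ℝ, (ENNReal.ofReal x).toReal - (ENNReal.ofReal (-x)).toReal = x := by
    intro x
    rcases le_total 0 x with hx | hx
    · rw [ENNReal.toReal_ofReal hx, ENNReal.ofReal_of_nonpos (by linarith)]; simp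
    · rw [ENNReal.toReal_ofReal (by linarith : 0 ≤ -x), ENNReal.ofReal_of_nonpos hx]; simp
  have d1 := hdecomp w
  have d2 := hdecomp (1 - w)
  have hc : ∀ x : ℝ, ENNReal.ofReal x ≠ ⊤ := fun x => ENNReal.ofReal_ne_top
  generalize ha : ENNReal.ofReal w = p at d1
  generalize hb : ENNReal.ofReal (-w) = p' at d1
  generalize hc1 : ENNReal.ofReal (1 - w) = r at d2
  generalize hc2 : ENNReal.ofReal (-(1 - w)) = r' at d2
  have hp : p ≠ ⊤ := ha ▸ hc _
  have hp' : p' ≠ ⊤ := hb ▸ hc _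
  have hr : r ≠ ⊤ := hc1 ▸ hc _
  have hr' : r' ≠ ⊤ := hc2 ▸ hc _
  have := Measure.smul_finite μ₁ hp
  have := Measure.smul_finite μ₁ hp'
  have := Measure.smul_finite μ₂ hr
  have := Measure.smul_finite μ₂ hr'
  -- The negative parts of the weights are moved to the side of `μ`, so that both sides are positive
  -- finite measures.
  have hm : μ + p' • μ₁ + r' • μ₂ = p • μ₁ + r • μ₂ := by
    refine ext_of_laplace_eq ?_ ?_ ?_
    · simp only [ae_add_measure_iff]
      exact ⟨⟨hμ, Measure.ae_smul_measure hμ₁ _⟩, Measure.ae_smul_measure hμ₂ _⟩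
    · simp only [ae_add_measure_iff]
      exact ⟨Measure.ae_smul_measure hμ₁ _, Measure.ae_smul_measure hμ₂ _⟩
    · intro s hs
      have i0 := integrable_exp_neg_mul_of_nonneg hμ hs
      have i1 := integrable_exp_neg_mul_of_nonneg hμ₁ hs
      have i2 := integrable_exp_neg_mul_of_nonneg hμ₂ hs
      rw [integral_add_measure (i0.add_measure (i1.smul_measure hp')) (i2.smul_measure hr'),
        integral_add_measure i0 (i1.smul_measure hp'),
        integral_add_measure (i1.smul_measure hp) (i2.smul_measure hr)]
      simp only [integral_smul_measure, smul_eq_mul]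
      rw [h' s hs]
      linear_combination -(∫ x, Real.exp (-(s * x)) ∂μ₁) * d1 - (∫ x, Real.exp (-(s * x)) ∂μ₂) * d2
  have hA : (μ + p' • μ₁ + r' • μ₂).real A = (p • μ₁ + r • μ₂).real A := by rw [hm]
  rw [measureReal_add_apply (measure_ne_top _ _) (measure_ne_top _ _),
    measureReal_add_apply (measure_ne_top _ _) (measure_ne_top _ _),
    measureReal_add_apply (measure_ne_top _ _) (measure_ne_top _ _)] at hA
  simp only [measureReal_ennreal_smul_apply] at hA
  linear_combination hA + μ₁.real A * d1 + μ₂.real A * d2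

lemma ae_nonneg_gammaMeasure (k r : ℝ) : ∀ᵐ x ∂gammaMeasure k r, 0 ≤ x := by
  have : gammaMeasure k r (Set.Iio 0) = 0 := by
    rw [gammaMeasure, withDensity_apply _ measurableSet_Iio]
    exact lintegral_gammaPDF_of_nonpos le_rfl
  filter_upwards [measure_eq_zero_iff_ae_notMem.1 this] with x hx
  simpa using hx

lemma ae_nonneg_expMeasure (r : ℝ) : ∀ᵐ x ∂expMeasure r, 0 ≤ x :=
  ae_nonneg_gammaMeasure 1 r

lemma integral_gammaMeasure {k r : ℝ} (hk : 0 < k) (hr : 0 < r) (f : ℝ → ℝ) :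
    ∫ x, f x ∂(gammaMeasure k r) = ∫ x in Set.Ioi 0, gammaPDFReal k r x * f x := by
  rw [gammaMeasure, show gammaPDF k r = fun x => ENNReal.ofReal (gammaPDFReal k r x) from rfl,
    integral_withDensity_eq_integral_toReal_smul
    (measurable_gammaPDFReal k r).ennreal_ofReal (by simp),
    ← integral_Ici_eq_integral_Ioi, ← integral_indicator measurableSet_Ici]
  congr 1; ext x
  by_cases hx : 0 ≤ x
  · simp [hx, ENNReal.toReal_ofReal, gammaPDFReal_nonneg hk hr]
  · simp [hx, gammaPDFReal]

/-- The Laplace transform of a gamma distribution. -/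
lemma laplace_gammaMeasure {k r s : ℝ} (hk : 0 < k) (hr : 0 < r) (hs : 0 < s) :
    ∫ x, Real.exp (-(s * x)) ∂(gammaMeasure k r) = (r / (s + r)) ^ k := by
  rw [integral_gammaMeasure hk hr]
  have h : ∀ x ∈ Set.Ioi (0 : ℝ), gammaPDFReal k r x * Real.exp (-(s * x)) =
      r ^ k / Real.Gamma k * (x ^ (k - 1) * Real.exp (-((s + r) * x))) := by
    intro x hx
    rw [gammaPDFReal, if_pos (le_of_lt hx), show -((s + r) * x) = -(r * x) + -(s * x) by ring,
      Real.exp_add]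
    ring
  rw [setIntegral_congr_fun measurableSet_Ioi h, integral_const_mul,
    Real.integral_rpow_mul_exp_neg_mul_Ioi hk (by linarith), Real.div_rpow hr.le (by linarith),
    Real.div_rpow zero_le_one (by linarith)]
  have := (Real.Gamma_pos_of_pos hk).ne'
  simp
  field_simp

lemma laplace_expMeasure {r s : ℝ} (hr : 0 < r) (hs : 0 < s) :
    ∫ x, Real.exp (-(s * x)) ∂(expMeasure r) = r / (s + r) := by
  rw [expMeasure, laplace_gammaMeasure zero_lt_one hr hs, Real.rpow_one]

lemma gammaMeasure_two_real_Iic {r : ℝ} (hr : 0 < r) {t : ℝ} (ht : 0 ≤ t) :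
    (gammaMeasure 2 r).real (Set.Iic t) = 1 - (1 + r * t) * Real.exp (-(r * t)) := by
  have := isProbabilityMeasure_gammaMeasure two_pos hr
  have h := integral_gammaMeasure two_pos hr ((Set.Iic t).indicator fun _ => 1)
  rw [integral_indicator_const _ measurableSet_Iic, smul_eq_mul, mul_one] at h
  rw [h]
  have h1 : ∀ x ∈ Set.Ioi (0 : ℝ), gammaPDFReal 2 r x * (Set.Iic t).indicator (fun _ => 1) x =
      (Set.Iic t).indicator (fun x => r ^ 2 * x * Real.exp (-(r * x))) x := by
    intro x hx
    by_cases hxt : x ≤ t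
    · have : (2 : ℝ) - 1 = 1 := by norm_num
      simp [hxt, gammaPDFReal, (Set.mem_Ioi.1 hx).le, this]
    · simp [hxt]
  rw [setIntegral_congr_fun measurableSet_Ioi h1, setIntegral_indicator measurableSet_Iic,
    Set.Ioi_inter_Iic, ← intervalIntegral.integral_of_le ht,
    intervalIntegral.integral_eq_sub_of_hasDerivAt
      (f := fun x => -((1 + r * x) * Real.exp (-(r * x))))]
  · simp; ring
  · intro x _
    have h2 : HasDerivAt (fun x => 1 + r * x) r x := by
      simpa using ((hasDerivAt_id x).const_mul r).const_add 1
    convert! (h2.mul (hasDerivAt_exp_neg_mul r x)).neg using 1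
    ring
  · exact Continuous.intervalIntegrable (by fun_prop) _ _

end MGInfinity

end

/-! ### Path analysis: the busy cycle ends at the first gap. -/

noncomputable section

namespace MGInfinity

variable {Ω : Type*}

/-- Time from the arrival of customer `n` until the customers `0, …, n` have all left. -/
def residualTime (T S : ℕ → Ω → ℝ) : ℕ → Ω → ℝ
  | 0, ω => S 0 ω
  | n + 1, ω => max (residualTime T S n ω - T (n + 1) ω) (S (n + 1) ω)

open Classical in
/-- The time at which the customers that arrived before the first gap have all left. -/
def cycleEnd (T S : ℕ → Ω → ℝ) (ω : Ω) : ℝ :=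
  if h : ∃ n, residualTime T S n ω < T (n + 1) ω then
    arrivalTime T (Nat.find h) ω + residualTime T S (Nat.find h) ω
  else 0

variable {T S : ℕ → Ω → ℝ} {ω : Ω}

lemma arrivalTime_succ (T : ℕ → Ω → ℝ) (n : ℕ) (ω : Ω) :
    arrivalTime T (n + 1) ω = arrivalTime T n ω + T (n + 1) ω :=
  Finset.sum_range_succ _ _

lemma arrivalTime_strictMono (hT : ∀ n, 0 < T n ω) : StrictMono fun n => arrivalTime T n ω :=
  strictMono_nat_of_lt_succ fun n => by
    have := hT (n + 1)
    rw [arrivalTime_succ]; linarith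

lemma arrivalTime_add_residualTime_succ (n : ℕ) :
    arrivalTime T (n + 1) ω + residualTime T S (n + 1) ω =
      max (arrivalTime T n ω + residualTime T S n ω) (arrivalTime T (n + 1) ω + S (n + 1) ω) := by
  rw [residualTime, ← max_add_add_left, arrivalTime_succ]
  congr 1; ring

lemma departure_le {i n : ℕ} (h : i ≤ n) :
    arrivalTime T i ω + S i ω ≤ arrivalTime T n ω + residualTime T S n ω := by
  induction n with
  | zero => rw [Nat.le_zero.1 h]; rfl
  | succ n ih =>
    rw [arrivalTime_add_residualTime_succ]
    rcases h.eq_or_lt with rfl | h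
    · exact le_max_right _ _
    · exact (ih (Nat.lt_succ_iff.1 h)).trans (le_max_left _ _)

/-- The bound of `departure_le` is attained: an actual customer departs last, so emptiness of the
system at a given time can be applied to that customer. -/
lemma exists_departure_eq (n : ℕ) :
    ∃ i ≤ n, arrivalTime T i ω + S i ω = arrivalTime T n ω + residualTime T S n ω := by
  induction n with
  | zero => exact ⟨0, le_rfl, rfl⟩
  | succ n ih =>
    obtain ⟨i, hi, h⟩ := ih
    rw [arrivalTime_add_residualTime_succ]
    rcases le_total (arrivalTime T n ω + residualTime T S n ω)
      (arrivalTime T (n + 1) ω + S (n + 1) ω) with h' | h'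
    · exact ⟨n + 1, le_rfl, (max_eq_right h').symm⟩
    · exact ⟨i, hi.trans n.le_succ, by rw [max_eq_left h', h]⟩

lemma residualTime_nonneg (hS : ∀ n, 0 ≤ S n ω) (n : ℕ) : 0 ≤ residualTime T S n ω := by
  cases n with
  | zero => exact hS 0
  | succ n => exact le_max_of_le_right (hS _)

lemma numberInSystem_eq_zero_iff (t : ℝ) :
    numberInSystem T S t ω = 0 ↔ ∀ n, arrivalTime T n ω ≤ t → arrivalTime T n ω + S n ω ≤ t := by
  simp [numberInSystem, Set.encard_eq_zero, Set.eq_empty_iff_forall_notMem]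

/-- If the arrivals come one at a time and there is a gap, then the busy cycle ends when the
customers that arrived before the first gap have left. -/
lemma busyCycle_eq_cycleEnd (hT : ∀ n, 0 < T n ω) (hS : ∀ n, 0 ≤ S n ω)
    (h : ∃ n, residualTime T S n ω < T (n + 1) ω) :
    busyCycle T S ω = (cycleEnd T S ω : EReal) := by
  classical
  have hend : cycleEnd T S ω =
      arrivalTime T (Nat.find h) ω + residualTime T S (Nat.find h) ω := by
    rw [cycleEnd, dif_pos h]
  have hN := Nat.find_spec h
  have hmin : ∀ m < Nat.find h, T (m + 1) ω ≤ residualTime T S m ω :=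
    fun m hm => not_lt.1 (Nat.find_min h hm)
  generalize Nat.find h = N at hend hN hmin
  have hA := arrivalTime_strictMono hT
  have hidle : idlePeriod T ω ≤ cycleEnd T S ω := by
    rw [hend]
    have h1 : arrivalTime T 0 ω ≤ arrivalTime T N ω := hA.monotone (Nat.zero_le N)
    have h2 := residualTime_nonneg (T := T) hS N
    unfold idlePeriod; linarith
  have hleast : IsLeast {u : ℝ | 0 ≤ u ∧ numberInSystem T S (idlePeriod T ω + u) ω = 0}
      (cycleEnd T S ω - idlePeriod T ω) := by
    refine ⟨⟨sub_nonneg.2 hidle, ?_⟩, ?_⟩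
    · rw [add_sub_cancel, numberInSystem_eq_zero_iff]
      intro n hn
      -- A later customer arrives strictly after the end of the cycle, because the gap inequality at
      -- `N` is strict.
      have hnN : n ≤ N := by
        by_contra! hlt
        have h1 : arrivalTime T (N + 1) ω ≤ arrivalTime T n ω := hA.monotone hlt
        rw [arrivalTime_succ] at h1
        linarith
      rw [hend]
      exact departure_le hnN
    · rintro u ⟨hu, hzero⟩
      rw [numberInSystem_eq_zero_iff] at hzero
      by_contra! hlt
      -- If the system is empty at a time by which customer `n` has arrived, the last departure
      -- among `0, …, n` has occurred. Without a gap at `n`, customer `n + 1` arrived no later than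
      -- that departure. So an empty time before the end would come after all arrivals up to `N`,
      -- hence after the last departure.
      have hstep : ∀ n ≤ N, arrivalTime T n ω ≤ idlePeriod T ω + u := by
        intro n
        induction n with
        | zero => intro _; unfold idlePeriod; linarith
        | succ n ih =>
          intro hn
          have hn' := ih (Nat.le_of_succ_le hn)
          obtain ⟨i, hi, hdep⟩ := exists_departure_eq (T := T) (S := S) (ω := ω) n
          have h1 : arrivalTime T i ω ≤ arrivalTime T n ω := hA.monotone hi
          have h2 := hzero i (h1.trans hn')
          have h3 := hmin n hn
          rw [arrivalTime_succ]
          linarith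
      obtain ⟨i, hi, hdep⟩ := exists_departure_eq (T := T) (S := S) (ω := ω) N
      have h1 : arrivalTime T i ω ≤ arrivalTime T N ω := hA.monotone hi
      have h2 := hzero i (h1.trans (hstep N le_rfl))
      linarith
  have hbusy : busyPeriod T S ω = ((cycleEnd T S ω - idlePeriod T ω : ℝ) : EReal) :=
    ((EReal.coe_strictMono.monotone.map_isLeast hleast).isGLB).sInf_eq
  rw [busyCycle, hbusy, ← EReal.coe_add, add_sub_cancel]

lemma cycleEnd_nonneg (hT : ∀ n, 0 < T n ω) (hS : ∀ n, 0 ≤ S n ω) : 0 ≤ cycleEnd T S ω := by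
  unfold cycleEnd
  split_ifs with h
  · exact add_nonneg (Finset.sum_nonneg fun i _ => (hT i).le) (residualTime_nonneg hS _)
  · exact le_rfl

section Measurable

variable {mΩ : MeasurableSpace Ω}

lemma measurable_arrivalTime {n : ℕ} (hT : ∀ i ≤ n, Measurable (T i)) :
    Measurable (arrivalTime T n) :=
  Finset.measurable_fun_sum _ fun i hi => hT i (Finset.mem_range_succ_iff.1 hi)

lemma measurable_residualTime {n : ℕ} (hT : ∀ i ≤ n, Measurable (T i))
    (hS : ∀ i ≤ n, Measurable (S i)) : Measurable (residualTime T S n) := by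
  induction n with
  | zero => exact hS 0 le_rfl
  | succ n ih =>
    exact ((ih (fun i hi => hT i (hi.trans n.le_succ)) fun i hi => hS i (hi.trans n.le_succ)).sub
      (hT _ le_rfl)).max (hS _ le_rfl)

lemma measurable_cycleEnd (hT : ∀ n, Measurable (T n)) (hS : ∀ n, Measurable (S n)) :
    Measurable (cycleEnd T S) := by
  classical
  have hs : ∀ n, MeasurableSet {ω | residualTime T S n ω < T (n + 1) ω} := fun n =>
    measurableSet_lt (measurable_residualTime (fun i _ => hT i) fun i _ => hS i) (hT _)
  have hex : MeasurableSet {ω | ∃ n, residualTime T S n ω < T (n + 1) ω} := by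
    simpa only [Set.ofPred_exists] using MeasurableSet.iUnion hs
  -- `Measurable.find` needs a predicate that is satisfiable for every `ω`. The added alternative
  -- holds only where there is no gap, and there the value is overridden by `0`.
  have hex' : ∀ ω, ∃ n, residualTime T S n ω < T (n + 1) ω ∨
      ¬ ∃ m, residualTime T S m ω < T (m + 1) ω := fun ω => by
    by_cases h : ∃ m, residualTime T S m ω < T (m + 1) ω
    · exact h.imp fun _ => Or.inl
    · exact ⟨0, Or.inr h⟩
  have hfind := Measurable.find
    (f := fun n ω => arrivalTime T n ω + residualTime T S n ω)
    (p := fun n ω => residualTime T S n ω < T (n + 1) ω ∨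
      ¬ ∃ m, residualTime T S m ω < T (m + 1) ω)
    (fun n => (measurable_arrivalTime fun i _ => hT i).add (measurable_residualTime (fun i _ => hT i) fun i _ => hS i))
    (fun n => (hs n).union hex.compl)
    hex'
  have heq : cycleEnd T S = fun ω => if ∃ n, residualTime T S n ω < T (n + 1) ω then
      arrivalTime T (Nat.find (hex' ω)) ω + residualTime T S (Nat.find (hex' ω)) ω else 0 := by
    ext ω
    by_cases h : ∃ m, residualTime T S m ω < T (m + 1) ω
    · simp only [cycleEnd, h, dite_true, if_true, not_true_eq_false, or_false]
    · simp only [cycleEnd, dif_neg h, if_neg h]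
  rw [heq]
  exact Measurable.ite hex hfind measurable_const

end Measurable

end MGInfinity

end

/-! ### Discount factors along the chain and independence of the past. -/

noncomputable section

namespace MGInfinity

variable {Ω : Type*}

/-- The discount factor `exp (-(s * t))` at the arrival time `t` of customer `n` if this customer
arrives during the first busy period, and `0` otherwise. -/
def discount (s : ℝ) (T S : ℕ → Ω → ℝ) : ℕ → Ω → ℝ
  | 0, ω => Real.exp (-(s * T 0 ω))
  | n + 1, ω => if residualTime T S n ω < T (n + 1) ω then 0 else
      discount s T S n ω * Real.exp (-(s * T (n + 1) ω))

/-- The discount factor at the end of the first busy cycle if customer `n` is the last one that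
arrives during the cycle, and `0` otherwise. -/
def endDiscount (s : ℝ) (T S : ℕ → Ω → ℝ) (n : ℕ) (ω : Ω) : ℝ :=
  if residualTime T S n ω < T (n + 1) ω then
    discount s T S n ω * Real.exp (-(s * residualTime T S n ω)) else 0

section Pathwise

variable {T S : ℕ → Ω → ℝ} {s : ℝ} {ω : Ω}

lemma exp_neg_mul_arrivalTime_succ (s : ℝ) (T : ℕ → Ω → ℝ) (n : ℕ) (ω : Ω) :
    Real.exp (-(s * arrivalTime T (n + 1) ω)) =
      Real.exp (-(s * arrivalTime T n ω)) * Real.exp (-(s * T (n + 1) ω)) := by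
  rw [arrivalTime_succ, ← Real.exp_add]
  ring_nf

open Classical in
lemma discount_eq (s : ℝ) (T S : ℕ → Ω → ℝ) (n : ℕ) (ω : Ω) :
    discount s T S n ω = if ∃ m < n, residualTime T S m ω < T (m + 1) ω then 0 else
      Real.exp (-(s * arrivalTime T n ω)) := by
  induction n with
  | zero => simp [discount, arrivalTime]
  | succ n ih =>
    simp only [discount, ih, Nat.exists_lt_succ_right, exp_neg_mul_arrivalTime_succ]
    by_cases h1 : ∃ m < n, residualTime T S m ω < T (m + 1) ω
    · simp [h1]
    · by_cases h2 : residualTime T S n ω < T (n + 1) ω <;> simp only [h1, h2] <;> simp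

lemma discount_nonneg (n : ℕ) : 0 ≤ discount s T S n ω := by
  rw [discount_eq]
  split_ifs
  exacts [le_rfl, (Real.exp_pos _).le]

lemma discount_le (n : ℕ) : discount s T S n ω ≤ Real.exp (-(s * arrivalTime T n ω)) := by
  rw [discount_eq]
  split_ifs
  exacts [(Real.exp_pos _).le, le_rfl]

lemma discount_le_one (hs : 0 ≤ s) (hT : ∀ n, 0 < T n ω) (n : ℕ) : discount s T S n ω ≤ 1 :=
  (discount_le n).trans (Real.exp_le_one_iff.2 (neg_nonpos.2
    (mul_nonneg hs (Finset.sum_nonneg fun i _ => (hT i).le))))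

-- Only the index of the first gap can contribute a nonzero term: `discount` vanishes after that
-- gap, and no earlier index has one.
open Classical in
lemma sum_endDiscount (s : ℝ) (T S : ℕ → Ω → ℝ) (n : ℕ) (ω : Ω) :
    ∑ k ∈ Finset.range n, endDiscount s T S k ω =
      if ∃ m < n, residualTime T S m ω < T (m + 1) ω then
        Real.exp (-(s * cycleEnd T S ω)) else 0 := by
  induction n with
  | zero => simp
  | succ n ih =>
    rw [Finset.sum_range_succ, ih, endDiscount, discount_eq]
    simp only [Nat.exists_lt_succ_right]
    by_cases h1 : ∃ m < n, residualTime T S m ω < T (m + 1) ω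
    · simp [h1]
    · by_cases h2 : residualTime T S n ω < T (n + 1) ω
      · have h3 : ∃ m, residualTime T S m ω < T (m + 1) ω := ⟨n, h2⟩
        have h4 : Nat.find h3 = n :=
          (Nat.find_eq_iff h3).2 ⟨h2, fun m hm h => h1 ⟨m, hm, h⟩⟩
        have h5 : cycleEnd T S ω = arrivalTime T n ω + residualTime T S n ω := by
          rw [cycleEnd, dif_pos h3, h4]
        rw [if_neg h1, if_pos h2, if_neg h1, if_pos (Or.inr h2), h5, zero_add, ← Real.exp_add]
        ring_nf
      · simp [h1, h2]

/-- The pathwise form of the martingale step: the factor multiplying `discount s T S n ω` has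
conditional mean `φ` of the current residual time. -/
lemma discount_succ_mul_add_endDiscount (q a : ℝ) (n : ℕ) :
    discount s T S (n + 1) ω * residualTransform q a s (residualTime T S (n + 1) ω) +
      endDiscount s T S n ω =
    discount s T S n ω *
      stepTransform q a s (residualTime T S n ω) (T (n + 1) ω) (S (n + 1) ω) := by
  simp only [discount, endDiscount, stepTransform, residualTime]
  split_ifs <;> ring

lemma stepTransform_nonneg {q a : ℝ} (hq : 0 < q) (hq1 : q ≤ 1) (ha : 0 ≤ a) (hs : 0 < s)
    (v x y : ℝ) : 0 ≤ stepTransform q a s v x y := by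
  unfold stepTransform
  split_ifs
  · positivity
  · exact mul_nonneg (Real.exp_pos _).le (residualTransform_nonneg hq.le hq1 ha hs _)

lemma stepTransform_le_one {q a : ℝ} (hq : 0 < q) (hq1 : q ≤ 1) (ha : 0 ≤ a) (hs : 0 < s)
    {v x : ℝ} (hv : 0 ≤ v) (hx : 0 ≤ x) (y : ℝ) : stepTransform q a s v x y ≤ 1 := by
  unfold stepTransform
  split_ifs with h
  · exact Real.exp_le_one_iff.2 (by nlinarith)
  · refine mul_le_one₀ (Real.exp_le_one_iff.2 (by nlinarith))
      (residualTransform_nonneg hq.le hq1 ha hs _) (residualTransform_le_one hq.le hq1 ha hs ?_)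
    exact le_max_of_le_left (by linarith)

lemma measurable_stepTransform (q a s : ℝ) :
    Measurable fun p : ℝ × ℝ × ℝ => stepTransform q a s p.1 p.2.1 p.2.2 := by
  unfold stepTransform
  refine Measurable.ite (measurableSet_lt (by fun_prop) (by fun_prop)) (by fun_prop) ?_
  exact Continuous.measurable (by fun_prop)

lemma measurable_discount {m : MeasurableSpace Ω} {n : ℕ} (hT : ∀ i ≤ n, Measurable (T i))
    (hS : ∀ i ≤ n, Measurable (S i)) : Measurable (discount s T S n) := by
  induction n with
  | zero =>
    have := hT 0 le_rfl
    change Measurable fun ω => Real.exp (-(s * T 0 ω))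
    fun_prop
  | succ n ih =>
    have hT' := fun i (hi : i ≤ n) => hT i (hi.trans n.le_succ)
    have hS' := fun i (hi : i ≤ n) => hS i (hi.trans n.le_succ)
    have h1 := ih hT' hS'
    have h2 := hT (n + 1) le_rfl
    change Measurable fun ω => if residualTime T S n ω < T (n + 1) ω then 0 else
      discount s T S n ω * Real.exp (-(s * T (n + 1) ω))
    exact Measurable.ite (measurableSet_lt (measurable_residualTime hT' hS') h2)
      measurable_const (by fun_prop)

end Pathwise

namespace IsQueue

variable [MeasurableSpace Ω] {P : Measure Ω} {lam : ℝ} {G : ℝ → ℝ}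
  {T S : ℕ → Ω → ℝ}

lemma ae_pos_interarrival (hQ : IsQueue P lam G T S) : ∀ᵐ ω ∂P, ∀ n, 0 < T n ω := by
  refine ae_all_iff.2 fun n => ?_
  have h : ∀ᵐ x ∂(P.map (T n)), 0 < x := by
    rw [hQ.law_interarrival n, expMeasure]
    have hne : ∀ᵐ x ∂gammaMeasure 1 lam, x ≠ 0 :=
      (withDensity_absolutelyContinuous _ _).ae_le (Measure.ae_ne volume (0 : ℝ))
    filter_upwards [ae_nonneg_gammaMeasure 1 lam, hne] with x h1 h2
    exact lt_of_le_of_ne h1 h2.symm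
  exact ae_of_ae_map (hQ.measurable_interarrival n).aemeasurable h

/-- The past up to the arrival of customer `n` is independent of the next interarrival and service
times. -/
lemma indepFun_history (hQ : IsQueue P lam G T S) (s : ℝ) (n : ℕ) :
    IndepFun (fun ω => (discount s T S n ω, residualTime T S n ω))
      (fun ω => (T (n + 1) ω, S (n + 1) ω)) P := by
  have hle : ∀ i, MeasurableSpace.comap (Sum.elim T S i) (borel ℝ) ≤ ‹MeasurableSpace Ω› := by
    rintro (i | i)
    · exact (hQ.measurable_interarrival i).comap_le
    · exact (hQ.measurable_service i).comap_le
  -- Both kinds of variables share one index type; the past uses indices at most `n`, the next step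
  -- only `n + 1`.
  have hdisj : Disjoint {i : ℕ ⊕ ℕ | Sum.elim id id i ≤ n} {i | Sum.elim id id i = n + 1} := by
    rw [Set.disjoint_left]
    intro i (h1 : Sum.elim id id i ≤ n) (h2 : Sum.elim id id i = n + 1)
    omega
  have hind := indep_iSup_of_disjoint hle hQ.indep hdisj
  have hmeas : ∀ (A : Set (ℕ ⊕ ℕ)) (i : ℕ ⊕ ℕ), i ∈ A →
      Measurable[⨆ j ∈ A, MeasurableSpace.comap (Sum.elim T S j) (borel ℝ)] (Sum.elim T S i) :=
    fun A i hi => Measurable.mono (comap_measurable _)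
      (le_iSup₂ (f := fun j (_ : j ∈ A) => MeasurableSpace.comap (Sum.elim T S j) (borel ℝ)) i hi)
      le_rfl
  rw [IndepFun_iff_Indep]
  refine indep_of_indep_of_le_left (indep_of_indep_of_le_right hind ?_) ?_
  · exact Measurable.comap_le (Measurable.prodMk (hmeas _ (Sum.inl (n + 1)) rfl)
      (hmeas _ (Sum.inr (n + 1)) rfl))
  · have h1 := fun i (hi : i ≤ n) => hmeas {i | Sum.elim id id i ≤ n} (Sum.inl i) hi
    have h2 := fun i (hi : i ≤ n) => hmeas {i | Sum.elim id id i ≤ n} (Sum.inr i) hi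
    exact Measurable.comap_le
      (Measurable.prodMk (measurable_discount h1 h2) (measurable_residualTime h1 h2))

lemma indepFun_interarrival_service (hQ : IsQueue P lam G T S) (n : ℕ) :
    IndepFun (T n) (S n) P :=
  hQ.indep.indepFun (i := Sum.inl n) (j := Sum.inr n) (by simp)

variable [IsProbabilityMeasure P]

lemma ae_nonneg_service (hQ : IsQueue P lam G T S) (hG : ∀ t < 0, G t = 0) :
    ∀ᵐ ω ∂P, ∀ n, 0 ≤ S n ω := by
  refine ae_all_iff.2 fun n => ?_
  have h : ∀ k : ℕ, ∀ᵐ ω ∂P, ¬ S n ω ≤ -(1 / ((k : ℝ) + 1)) := by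
    intro k
    have h1 := hQ.law_service n (-(1 / ((k : ℝ) + 1)))
    rw [hG _ (neg_lt_zero.2 Nat.one_div_pos_of_nat), measureReal_eq_zero_iff] at h1
    exact measure_eq_zero_iff_ae_notMem.1 h1
  filter_upwards [ae_all_iff.2 h] with ω hω
  by_contra! hneg
  obtain ⟨k, hk⟩ := exists_nat_one_div_lt (neg_pos.2 hneg)
  exact hω k (by linarith)

lemma isProbabilityMeasure_service (hQ : IsQueue P lam G T S) (n : ℕ) :
    IsProbabilityMeasure (P.map (S n)) :=
  Measure.isProbabilityMeasure_map (hQ.measurable_service n).aemeasurable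

lemma service_real_Ioi (hQ : IsQueue P lam G T S) (n : ℕ) (t : ℝ) :
    (P.map (S n)).real (Set.Ioi t) = 1 - G t := by
  have := hQ.isProbabilityMeasure_service n
  rw [← Set.compl_Iic, probReal_compl_eq_one_sub measurableSet_Iic,
    map_measureReal_apply (hQ.measurable_service n) measurableSet_Iic, ← hQ.law_service n t]
  rfl

end IsQueue

end MGInfinity

end

/-! ### The Laplace transform of the busy cycle and the almost sure occurrence of a gap. -/

noncomputable section

namespace MGInfinity

namespace IsQueue

variable {Ω : Type*} [MeasurableSpace Ω] {P : Measure Ω} {lam : ℝ}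
  {G : ℝ → ℝ} {T S : ℕ → Ω → ℝ} {q a s : ℝ}

lemma measurable_endDiscount (hQ : IsQueue P lam G T S) (s : ℝ) (n : ℕ) :
    Measurable (endDiscount s T S n) := by
  have hT := hQ.measurable_interarrival
  have hS := hQ.measurable_service
  have h1 : Measurable (discount s T S n) :=
    measurable_discount (fun i _ => hT i) fun i _ => hS i
  have h2 : Measurable (residualTime T S n) :=
    measurable_residualTime (fun i _ => hT i) fun i _ => hS i
  exact Measurable.ite (measurableSet_lt h2 (hT _)) (by fun_prop) measurable_const

lemma integral_exp_neg_arrivalTime (hQ : IsQueue P lam G T S) (hlam : 0 < lam) (hs : 0 < s)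
    (n : ℕ) : ∫ ω, Real.exp (-(s * arrivalTime T n ω)) ∂P = (lam / (s + lam)) ^ (n + 1) := by
  have hT := hQ.measurable_interarrival
  have hind : iIndepFun T P :=
    iIndepFun.precomp (g := Sum.inl) Sum.inl_injective hQ.indep
  have h := hind.mgf_sum (t := -s) hT (Finset.range (n + 1))
  have h1 : ∀ i, mgf (T i) P (-s) = lam / (s + lam) := by
    intro i
    rw [← laplace_expMeasure hlam hs, ← hQ.law_interarrival i,
      integral_map (hT i).aemeasurable (Measurable.aestronglyMeasurable (by fun_prop))]
    simp [mgf]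
  simp only [h1, Finset.prod_const, Finset.card_range] at h
  rw [← h]
  simp [mgf, arrivalTime]

variable [IsProbabilityMeasure P]

lemma map_history_prod (hQ : IsQueue P lam G T S) (s : ℝ) (n : ℕ) :
    P.map (fun ω => ((discount s T S n ω, residualTime T S n ω), (T (n + 1) ω, S (n + 1) ω))) =
      (P.map fun ω => (discount s T S n ω, residualTime T S n ω)).prod
        ((expMeasure lam).prod (P.map (S (n + 1)))) := by
  have hT := hQ.measurable_interarrival
  have hS := hQ.measurable_service
  have h1 : Measurable fun ω => (discount s T S n ω, residualTime T S n ω) :=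
    (measurable_discount (fun i _ => hT i) fun i _ => hS i).prodMk
      (measurable_residualTime (fun i _ => hT i) fun i _ => hS i)
  rw [(indepFun_iff_map_prod_eq_prod_map_map h1.aemeasurable
      ((hT _).prodMk (hS _)).aemeasurable).1 (hQ.indepFun_history s n),
    (indepFun_iff_map_prod_eq_prod_map_map (hT _).aemeasurable
      (hS _).aemeasurable).1 (hQ.indepFun_interarrival_service (n + 1)), hQ.law_interarrival]

lemma integrable_discount_mul_residualTransform (hQ : IsQueue P lam G T S)
    (hG : ∀ t < 0, G t = 0) (hq : 0 < q) (hq1 : q ≤ 1) (ha : 0 ≤ a) (hs : 0 < s) (n : ℕ) :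
    Integrable (fun ω => discount s T S n ω * residualTransform q a s (residualTime T S n ω)) P := by
  have hT := hQ.measurable_interarrival
  have hS := hQ.measurable_service
  have h1 : Measurable (discount s T S n) :=
    measurable_discount (fun i _ => hT i) fun i _ => hS i
  have h2 : Measurable (residualTime T S n) :=
    measurable_residualTime (fun i _ => hT i) fun i _ => hS i
  refine Integrable.of_bound
    (h1.mul ((continuous_residualTransform q a s).measurable.comp h2)).aestronglyMeasurable 1 ?_
  filter_upwards [hQ.ae_pos_interarrival, hQ.ae_nonneg_service hG] with ω hω1 hω2
  rw [Real.norm_of_nonneg (mul_nonneg (discount_nonneg n)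
    (residualTransform_nonneg hq.le hq1 ha hs _))]
  exact mul_le_one₀ (discount_le_one hs.le hω1 n) (residualTransform_nonneg hq.le hq1 ha hs _)
    (residualTransform_le_one hq.le hq1 ha hs (residualTime_nonneg hω2 n))

lemma integrable_endDiscount (hQ : IsQueue P lam G T S)
    (hG : ∀ t < 0, G t = 0) (hs : 0 < s) (n : ℕ) : Integrable (endDiscount s T S n) P := by
  refine Integrable.of_bound (hQ.measurable_endDiscount s n).aestronglyMeasurable 1 ?_
  filter_upwards [hQ.ae_pos_interarrival, hQ.ae_nonneg_service hG] with ω hω1 hω2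
  unfold endDiscount
  split_ifs
  · rw [Real.norm_of_nonneg (mul_nonneg (discount_nonneg n) (Real.exp_pos _).le)]
    exact mul_le_one₀ (discount_le_one hs.le hω1 n) (Real.exp_pos _).le
      (Real.exp_le_one_iff.2 (neg_nonpos.2 (mul_nonneg hs.le (residualTime_nonneg hω2 n))))
  · simp

/-- Conservation of expectation. The past is independent of the next interarrival and service times,
so these are integrated out first, with the past frozen, by `integral_stepTransform`. -/
lemma integral_discount_succ (hQ : IsQueue P lam G T S) (hG : ∀ t < 0, G t = 0)
    (hlam : 0 < lam) (hq : 0 < q) (hq1 : q ≤ 1) (ha : 0 ≤ a) (hs : 0 < s)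
    (htail : ∀ x, 0 ≤ x → 1 - G x = (1 - q) * a / (lam * q * (Real.exp (a * x) - 1) + lam))
    (n : ℕ) :
    ∫ ω, discount s T S (n + 1) ω *
        residualTransform q a s (residualTime T S (n + 1) ω) ∂P + ∫ ω, endDiscount s T S n ω ∂P =
      ∫ ω, discount s T S n ω * residualTransform q a s (residualTime T S n ω) ∂P := by
  have hi1 := hQ.integrable_discount_mul_residualTransform hG hq hq1 ha hs (n + 1)
  have hi2 := hQ.integrable_endDiscount hG hs n
  have hT := hQ.measurable_interarrival
  have hS := hQ.measurable_service
  have h1 : Measurable (discount s T S n) :=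
    measurable_discount (fun i _ => hT i) fun i _ => hS i
  have h2 : Measurable (residualTime T S n) :=
    measurable_residualTime (fun i _ => hT i) fun i _ => hS i
  have hhist : Measurable fun ω => (discount s T S n ω, residualTime T S n ω) := h1.prodMk h2
  have hall : Measurable fun ω =>
      ((discount s T S n ω, residualTime T S n ω), (T (n + 1) ω, S (n + 1) ω)) :=
    hhist.prodMk ((hT _).prodMk (hS _))
  have hΦ : Measurable fun p : (ℝ × ℝ) × ℝ × ℝ =>
      p.1.1 * stepTransform q a s p.1.2 p.2.1 p.2.2 :=
    (by fun_prop : Measurable fun p : (ℝ × ℝ) × ℝ × ℝ => p.1.1).mul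
      ((measurable_stepTransform q a s).comp
        (by fun_prop : Measurable fun p : (ℝ × ℝ) × ℝ × ℝ => (p.1.2, p.2.1, p.2.2)))
  rw [← integral_add hi1 hi2]
  have hint := hi1.add hi2
  simp only [Pi.add_def, discount_succ_mul_add_endDiscount] at hint ⊢
  have hmap := integral_map (μ := P) hall.aemeasurable hΦ.aestronglyMeasurable
  have hintmap := (integrable_map_measure (μ := P) hΦ.aestronglyMeasurable hall.aemeasurable).2 hint
  have := isProbabilityMeasure_expMeasure hlam
  have := hQ.isProbabilityMeasure_service (n + 1)
  rw [hQ.map_history_prod s n] at hmap hintmap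
  rw [← hmap, integral_prod _ hintmap]
  have hinner : ∀ᵐ p ∂(P.map fun ω => (discount s T S n ω, residualTime T S n ω)),
      ∫ z, p.1 * stepTransform q a s p.2 z.1 z.2 ∂((expMeasure lam).prod (P.map (S (n + 1)))) =
        p.1 * residualTransform q a s p.2 := by
    have hnn : ∀ᵐ p ∂(P.map fun ω => (discount s T S n ω, residualTime T S n ω)), 0 ≤ p.2 := by
      rw [ae_map_iff hhist.aemeasurable (measurableSet_le measurable_const measurable_snd)]
      filter_upwards [hQ.ae_nonneg_service hG] with ω hω
      exact residualTime_nonneg hω n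
    filter_upwards [hnn] with p hp
    have hm : Measurable fun z : ℝ × ℝ => stepTransform q a s p.2 z.1 z.2 :=
      (measurable_stepTransform q a s).comp
        (by fun_prop : Measurable fun z : ℝ × ℝ => (p.2, z.1, z.2))
    have hstep : Integrable (fun z : ℝ × ℝ => stepTransform q a s p.2 z.1 z.2)
        ((expMeasure lam).prod (P.map (S (n + 1)))) := by
      refine Integrable.of_bound hm.aestronglyMeasurable 1 ?_
      have hx : ∀ᵐ z ∂((expMeasure lam).prod (P.map (S (n + 1)))), 0 ≤ z.1 :=
        Measure.quasiMeasurePreserving_fst.ae (ae_nonneg_expMeasure lam)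
      filter_upwards [hx] with z hz
      rw [Real.norm_of_nonneg (stepTransform_nonneg hq hq1 ha hs _ _ _)]
      exact stepTransform_le_one hq hq1 ha hs hp hz _
    rw [integral_const_mul, integral_prod _ hstep, integral_stepTransform (P.map (S (n + 1)))
      hlam hq ha hs (fun x hx => by rw [hQ.service_real_Ioi, htail x hx]) hp]
  rw [integral_congr_ae hinner, integral_map hhist.aemeasurable]
  exact (measurable_fst.mul
    ((continuous_residualTransform q a s).measurable.comp measurable_snd)).aestronglyMeasurable

lemma integral_discount_zero (hQ : IsQueue P lam G T S) (hG : ∀ t < 0, G t = 0)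
    (hlam : 0 < lam) (hq : 0 < q) (ha : 0 ≤ a) (hs : 0 < s)
    (htail : ∀ x, 0 ≤ x → 1 - G x = (1 - q) * a / (lam * q * (Real.exp (a * x) - 1) + lam)) :
    ∫ ω, discount s T S 0 ω * residualTransform q a s (residualTime T S 0 ω) ∂P =
      1 - s * (s + a) / ((s + q * a) * (s + lam)) := by
  have hT := hQ.measurable_interarrival
  have hS := hQ.measurable_service
  have := hQ.isProbabilityMeasure_service 0
  have hb := (continuous_residualTransform q a s).measurable
  have hexp : Measurable fun x => Real.exp (-(s * x)) := by fun_prop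
  have h := (hQ.indepFun_interarrival_service 0).integral_fun_comp_mul_comp
    (f := fun x => Real.exp (-(s * x))) (g := residualTransform q a s)
    (hT 0).aemeasurable (hS 0).aemeasurable hexp.aestronglyMeasurable hb.aestronglyMeasurable
  refine h.trans ?_
  have h1 : ∫ ω, Real.exp (-(s * T 0 ω)) ∂P = lam / (s + lam) := by
    rw [← laplace_expMeasure hlam hs, ← hQ.law_interarrival 0,
      integral_map (hT 0).aemeasurable hexp.aestronglyMeasurable]
  -- Service times are almost surely nonnegative, so the opening service is the case `r = 0` of
  -- `integral_residualTransform_max`.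
  have h2 : ∫ ω, residualTransform q a s (S 0 ω) ∂P =
      ∫ y, residualTransform q a s (max 0 y) ∂(P.map (S 0)) := by
    rw [integral_map (hS 0).aemeasurable (by
      exact (hb.comp (measurable_const.max measurable_id)).aestronglyMeasurable)]
    refine integral_congr_ae ?_
    filter_upwards [hQ.ae_nonneg_service hG] with ω hω
    rw [max_eq_right (hω 0)]
  have hpos : s + q * a ≠ 0 := by positivity
  rw [h1, h2, integral_residualTransform_max (P.map (S 0)) hlam hq ha hs
    (fun x hx => by rw [hQ.service_real_Ioi, htail x hx]) le_rfl, residualTransform_zero hpos,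
    residualTransformDeriv]
  simp only [mul_zero, neg_zero, Real.exp_zero]
  have : s + lam ≠ 0 := by positivity
  field_simp
  ring

/-- Since `φ ≤ 1` on the half-line, the integrand is at most `exp(-s A_n)`, where `A_n` is the
arrival epoch, and its mean decays geometrically. No prior knowledge that the busy period ends is
required. -/
lemma tendsto_integral_discount (hQ : IsQueue P lam G T S) (hG : ∀ t < 0, G t = 0)
    (hlam : 0 < lam) (hq : 0 < q) (hq1 : q ≤ 1) (ha : 0 ≤ a) (hs : 0 < s) :
    Tendsto (fun n => ∫ ω, discount s T S n ω *
      residualTransform q a s (residualTime T S n ω) ∂P) atTop (𝓝 0) := by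
  have hlt : lam / (s + lam) < 1 := (div_lt_one (by positivity)).2 (by linarith)
  have hlim : Tendsto (fun n : ℕ => (lam / (s + lam)) ^ (n + 1)) atTop (𝓝 0) :=
    (tendsto_pow_atTop_nhds_zero_of_lt_one (by positivity) hlt).comp (tendsto_add_atTop_nat 1)
  refine squeeze_zero (fun n => integral_nonneg fun ω => mul_nonneg (discount_nonneg n)
    (residualTransform_nonneg hq.le hq1 ha hs _)) (fun n => ?_) hlim
  rw [← hQ.integral_exp_neg_arrivalTime hlam hs n]
  refine integral_mono_ae (hQ.integrable_discount_mul_residualTransform hG hq hq1 ha hs n) ?_ ?_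
  · have hA := measurable_arrivalTime (n := n) fun i _ => hQ.measurable_interarrival i
    refine Integrable.of_bound (Measurable.aestronglyMeasurable (by fun_prop)) 1 ?_
    filter_upwards [hQ.ae_pos_interarrival] with ω hω
    rw [Real.norm_of_nonneg (Real.exp_pos _).le]
    exact Real.exp_le_one_iff.2 (neg_nonpos.2
      (mul_nonneg hs.le (Finset.sum_nonneg fun i _ => (hω i).le)))
  · filter_upwards [hQ.ae_nonneg_service hG] with ω hω
    exact (mul_le_of_le_one_right (discount_nonneg n)
      (residualTransform_le_one hq.le hq1 ha hs (residualTime_nonneg hω n))).trans (discount_le n)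

open Classical in
lemma integral_exp_neg_cycleEnd_of_exists (hQ : IsQueue P lam G T S) (hG : ∀ t < 0, G t = 0)
    (hlam : 0 < lam) (hq : 0 < q) (hq1 : q ≤ 1) (ha : 0 ≤ a) (hs : 0 < s)
    (htail : ∀ x, 0 ≤ x → 1 - G x = (1 - q) * a / (lam * q * (Real.exp (a * x) - 1) + lam)) :
    ∫ ω, (if ∃ m, residualTime T S m ω < T (m + 1) ω then
      Real.exp (-(s * cycleEnd T S ω)) else 0) ∂P =
      1 - s * (s + a) / ((s + q * a) * (s + lam)) := by
  have hsum : ∀ n, ∫ ω, ∑ k ∈ Finset.range n, endDiscount s T S k ω ∂P =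
      1 - s * (s + a) / ((s + q * a) * (s + lam)) -
        ∫ ω, discount s T S n ω * residualTransform q a s (residualTime T S n ω) ∂P := by
    intro n
    rw [integral_finsetSum _ fun k _ => hQ.integrable_endDiscount hG hs k]
    induction n with
    | zero => simp [hQ.integral_discount_zero hG hlam hq ha hs htail]
    | succ n ih =>
      rw [Finset.sum_range_succ, ih, ← hQ.integral_discount_succ hG hlam hq hq1 ha hs htail n]
      ring
  have hlim1 : Tendsto (fun n => ∫ ω, ∑ k ∈ Finset.range n, endDiscount s T S k ω ∂P) atTop
      (𝓝 (1 - s * (s + a) / ((s + q * a) * (s + lam)))) := by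
    simp_rw [hsum]
    simpa using tendsto_const_nhds.sub (hQ.tendsto_integral_discount hG hlam hq hq1 ha hs)
  refine tendsto_nhds_unique ?_ hlim1
  -- For each `ω` the partial sums are eventually constant, by `sum_endDiscount`.
  refine tendsto_integral_of_dominated_convergence (fun _ => 1) (fun n =>
    (Finset.measurable_fun_sum _ fun k _ => hQ.measurable_endDiscount s k).aestronglyMeasurable)
    (integrable_const _) (fun n => ?_) (ae_of_all _ fun ω => ?_)
  · filter_upwards [hQ.ae_pos_interarrival, hQ.ae_nonneg_service hG] with ω hω1 hω2
    rw [sum_endDiscount]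
    split_ifs
    · rw [Real.norm_of_nonneg (Real.exp_pos _).le]
      exact Real.exp_le_one_iff.2 (neg_nonpos.2 (mul_nonneg hs.le (cycleEnd_nonneg hω1 hω2)))
    · simp
  · simp_rw [sum_endDiscount]
    by_cases h : ∃ m, residualTime T S m ω < T (m + 1) ω
    · obtain ⟨m, hm⟩ := id h
      refine tendsto_const_nhds.congr' ?_
      filter_upwards [eventually_gt_atTop m] with n hn
      rw [if_pos h, if_pos ⟨m, hn, hm⟩]
    · have h' : ∀ n, ¬ ∃ m < n, residualTime T S m ω < T (m + 1) ω :=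
        fun n ⟨m, _, hm⟩ => h ⟨m, hm⟩
      simp only [h, h', if_false]
      exact tendsto_const_nhds

/-- The transform restricted to the gap event is at most the probability of that event and at least
`1 - s / (q * lam)`; `s` is arbitrarily small. -/
lemma ae_exists_gap (hQ : IsQueue P lam G T S) (hG : ∀ t < 0, G t = 0)
    (hlam : 0 < lam) (hq : 0 < q) (hq1 : q ≤ 1) (ha : 0 ≤ a)
    (htail : ∀ x, 0 ≤ x → 1 - G x = (1 - q) * a / (lam * q * (Real.exp (a * x) - 1) + lam)) :
    ∀ᵐ ω ∂P, ∃ m, residualTime T S m ω < T (m + 1) ω := by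
  classical
  have hT := hQ.measurable_interarrival
  have hS := hQ.measurable_service
  set E : Set Ω := {ω | ∃ m, residualTime T S m ω < T (m + 1) ω} with hE
  have hEm : MeasurableSet E := by
    simp only [hE, Set.ofPred_exists]
    exact MeasurableSet.iUnion fun m => measurableSet_lt
      (measurable_residualTime (fun i _ => hT i) fun i _ => hS i) (hT _)
  have hbound : ∀ s : ℝ, 0 < s → 1 - s / (q * lam) ≤ P.real E := by
    intro s hs
    have h1 : s * (s + a) / ((s + q * a) * (s + lam)) ≤ s / (q * lam) := by
      rw [div_le_div_iff₀ (by positivity) (by positivity)]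
      have e1 : (s + a) * q ≤ s + q * a := by nlinarith
      have e2 : (s + a) * q * lam ≤ (s + q * a) * (s + lam) :=
        mul_le_mul e1 (by linarith) hlam.le (by positivity)
      nlinarith [mul_le_mul_of_nonneg_left e2 hs.le]
    have h2 := hQ.integral_exp_neg_cycleEnd_of_exists hG hlam hq hq1 ha hs htail
    have h3 : ∫ ω, (if ∃ m, residualTime T S m ω < T (m + 1) ω then
        Real.exp (-(s * cycleEnd T S ω)) else 0) ∂P ≤ ∫ ω, E.indicator (fun _ => 1) ω ∂P := by
      refine integral_mono_of_nonneg (ae_of_all _ fun ω => ?_)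
        ((integrable_const _).indicator hEm) ?_
      · simp only [Pi.zero_apply]
        split_ifs
        exacts [(Real.exp_pos _).le, le_rfl]
      · filter_upwards [hQ.ae_pos_interarrival, hQ.ae_nonneg_service hG] with ω hω1 hω2
        simp only [Set.indicator_apply, hE, Set.mem_ofPred_eq]
        split_ifs
        · exact Real.exp_le_one_iff.2
            (neg_nonpos.2 (mul_nonneg hs.le (cycleEnd_nonneg hω1 hω2)))
        · exact le_rfl
    rw [integral_indicator_const _ hEm, smul_eq_mul, mul_one] at h3
    linarith
  have hone : 1 ≤ P.real E := by
    refine le_of_forall_pos_le_add fun ε hε => ?_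
    have := hbound (ε * (q * lam)) (by positivity)
    rw [mul_div_cancel_right₀ _ (by positivity)] at this
    linarith
  have hP : P E = 1 := by
    have h1 := le_antisymm measureReal_le_one hone
    rw [measureReal_def, ENNReal.toReal_eq_one_iff] at h1
    exact h1
  exact (prob_compl_eq_zero_iff hEm).2 hP

/-- The Laplace transform of the length of the busy cycle. -/
lemma integral_exp_neg_cycleEnd (hQ : IsQueue P lam G T S) (hG : ∀ t < 0, G t = 0)
    (hlam : 0 < lam) (hq : 0 < q) (hq1 : q ≤ 1) (ha : 0 ≤ a) (hs : 0 < s)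
    (htail : ∀ x, 0 ≤ x → 1 - G x = (1 - q) * a / (lam * q * (Real.exp (a * x) - 1) + lam)) :
    ∫ ω, Real.exp (-(s * cycleEnd T S ω)) ∂P = 1 - s * (s + a) / ((s + q * a) * (s + lam)) := by
  classical
  rw [← hQ.integral_exp_neg_cycleEnd_of_exists hG hlam hq hq1 ha hs htail]
  refine integral_congr_ae ?_
  filter_upwards [hQ.ae_exists_gap hG hlam hq hq1 ha htail] with ω hω
  rw [if_pos hω]

lemma busyCycle_ae_eq (hQ : IsQueue P lam G T S) (hG : ∀ t < 0, G t = 0)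
    (hlam : 0 < lam) (hq : 0 < q) (hq1 : q ≤ 1) (ha : 0 ≤ a)
    (htail : ∀ x, 0 ≤ x → 1 - G x = (1 - q) * a / (lam * q * (Real.exp (a * x) - 1) + lam)) :
    busyCycle T S =ᵐ[P] fun ω => (cycleEnd T S ω : EReal) := by
  filter_upwards [hQ.ae_exists_gap hG hlam hq hq1 ha htail, hQ.ae_pos_interarrival,
    hQ.ae_nonneg_service hG] with ω h1 h2 h3
  exact busyCycle_eq_cycleEnd h2 h3 h1

end IsQueue

end MGInfinity

end

/-! ### Inversion of the transform for the given service law. -/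

noncomputable section

namespace MGInfinity

lemma serviceCDF_of_neg {lam rho beta t : ℝ} (ht : t < 0) : serviceCDF lam rho beta t = 0 :=
  if_pos ht

lemma one_sub_serviceCDF {lam rho beta t : ℝ} (ht : 0 ≤ t) :
    1 - serviceCDF lam rho beta t = (1 - Real.exp (-rho)) * (lam + beta) /
      (lam * Real.exp (-rho) * (Real.exp ((lam + beta) * t) - 1) + lam) := by
  rw [serviceCDF, if_neg (not_lt.2 ht)]
  ring

namespace IsQueue

variable {Ω : Type*} [MeasurableSpace Ω] {P : Measure Ω} [IsProbabilityMeasure P]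
  {lam rho beta : ℝ} {T S : ℕ → Ω → ℝ}

lemma aemeasurable_busyCycle (hQ : IsQueue P lam (serviceCDF lam rho beta) T S) (hlam : 0 < lam)
    (hrho : 0 < rho) (hbeta : -lam ≤ beta) : AEMeasurable (busyCycle T S) P :=
  ⟨_, (measurable_cycleEnd hQ.measurable_interarrival
      hQ.measurable_service).coe_real_ereal,
    hQ.busyCycle_ae_eq (fun _ => serviceCDF_of_neg) hlam (Real.exp_pos _)
      (Real.exp_le_one_iff.2 (by linarith)) (by linarith) fun _ => one_sub_serviceCDF⟩

/-- If the Laplace transform of the busy cycle length is an affine combination of two Laplace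
transforms, then its distribution function is the same combination of the two distribution
functions. -/
lemma busyCycleCDF_eq_of_laplace_eq (hQ : IsQueue P lam (serviceCDF lam rho beta) T S)
    (hlam : 0 < lam) (hrho : 0 < rho) (hbeta : -lam ≤ beta) {μ₁ μ₂ : Measure ℝ}
    [IsProbabilityMeasure μ₁] [IsProbabilityMeasure μ₂]
    (hμ₁ : ∀ᵐ x ∂μ₁, 0 ≤ x) (hμ₂ : ∀ᵐ x ∂μ₂, 0 ≤ x) (w : ℝ)
    (h : ∀ s : ℝ, 0 < s → 1 - s * (s + (lam + beta)) /
        ((s + Real.exp (-rho) * (lam + beta)) * (s + lam)) =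
      w * ∫ x, Real.exp (-(s * x)) ∂μ₁ + (1 - w) * ∫ x, Real.exp (-(s * x)) ∂μ₂) (t : ℝ) :
    busyCycleCDF P T S t = w * cdf μ₁ t + (1 - w) * cdf μ₂ t := by
  have hG : ∀ t < 0, serviceCDF lam rho beta t = 0 := fun _ => serviceCDF_of_neg
  have hq := Real.exp_pos (-rho)
  have hq1 : Real.exp (-rho) ≤ 1 := Real.exp_le_one_iff.2 (by linarith)
  have ha : 0 ≤ lam + beta := by linarith
  have htail := fun x (hx : (0 : ℝ) ≤ x) => one_sub_serviceCDF (lam := lam) (rho := rho)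
    (beta := beta) hx
  have hZ := measurable_cycleEnd hQ.measurable_interarrival hQ.measurable_service
  have : IsProbabilityMeasure (P.map (cycleEnd T S)) :=
    Measure.isProbabilityMeasure_map hZ.aemeasurable
  have h1 : busyCycleCDF P T S t = (P.map (cycleEnd T S)).real (Set.Iic t) := by
    rw [map_measureReal_apply hZ measurableSet_Iic, busyCycleCDF]
    refine measureReal_congr ?_
    filter_upwards [hQ.busyCycle_ae_eq hG hlam hq hq1 ha htail] with ω hω
    have : (busyCycle T S ω ≤ (t : EReal)) = (cycleEnd T S ω ≤ t) := by
      rw [hω, EReal.coe_le_coe_iff]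
    exact this
  rw [h1, cdf_eq_real, cdf_eq_real]
  refine measureReal_eq_of_laplace_eq ?_ hμ₁ hμ₂ w (fun s hs => ?_) _
  · rw [ae_map_iff hZ.aemeasurable measurableSet_Ici]
    filter_upwards [hQ.ae_pos_interarrival, hQ.ae_nonneg_service hG] with ω hω1 hω2
    exact cycleEnd_nonneg hω1 hω2
  · rw [← h s hs, integral_map hZ.aemeasurable (Measurable.aestronglyMeasurable (by fun_prop)),
      hQ.integral_exp_neg_cycleEnd hG hlam hq hq1 ha hs htail]

/-- Partial fractions with simple poles at `-q (lam + beta)` and `-lam`, where `q = exp (-rho)`. The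
first rate must be positive to define an exponential law, hence the strict bound on `beta`. -/
lemma busyCycleCDF_eq_mixture (hQ : IsQueue P lam (serviceCDF lam rho beta) T S)
    (hlam : 0 < lam) (hrho : 0 < rho) (hbeta : -lam < beta)
    (hne : lam - Real.exp (-rho) * (lam + beta) ≠ 0) (t : ℝ) :
    busyCycleCDF P T S t =
      (1 - Real.exp (-rho)) * (lam + beta) / (lam - Real.exp (-rho) * (lam + beta)) *
          cdf (expMeasure (Real.exp (-rho) * (lam + beta))) t +
        (1 - (1 - Real.exp (-rho)) * (lam + beta) / (lam - Real.exp (-rho) * (lam + beta))) *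
          cdf (expMeasure lam) t := by
  have ha : 0 < lam + beta := by linarith
  have hq := Real.exp_pos (-rho)
  have hmu : 0 < Real.exp (-rho) * (lam + beta) := mul_pos hq ha
  have := isProbabilityMeasure_expMeasure hlam
  have := isProbabilityMeasure_expMeasure hmu
  refine hQ.busyCycleCDF_eq_of_laplace_eq hlam hrho hbeta.le (ae_nonneg_expMeasure _)
    (ae_nonneg_expMeasure _) _ (fun s hs => ?_) t
  rw [laplace_expMeasure hlam hs, laplace_expMeasure hmu hs]
  have h1 : s + Real.exp (-rho) * (lam + beta) ≠ 0 := by positivity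
  have h2 : s + lam ≠ 0 := by positivity
  generalize Real.exp (-rho) = q at *
  generalize lam + beta = a at *
  have hw := div_mul_cancel₀ ((1 - q) * a) hne
  generalize (1 - q) * a / (lam - q * a) = w at *
  field_simp
  linear_combination s * hw

lemma busyCycleCDF_eq_exponential (hQ : IsQueue P lam (serviceCDF lam rho (-lam)) T S)
    (hlam : 0 < lam) (hrho : 0 < rho) (t : ℝ) :
    busyCycleCDF P T S t = cdf (expMeasure lam) t := by
  have := isProbabilityMeasure_expMeasure hlam
  have h := hQ.busyCycleCDF_eq_of_laplace_eq hlam hrho le_rfl (ae_nonneg_expMeasure lam)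
    (ae_nonneg_expMeasure lam) 0 (fun s hs => ?_) t
  · rw [h]; simp
  · rw [laplace_expMeasure hlam hs]
    have h2 : s + lam ≠ 0 := by positivity
    simp only [add_neg_cancel, mul_zero, add_zero]
    field_simp
    ring

/-- The two poles merge. The transform is then `(1 - beta / lam) L + (beta / lam) L ^ 2` with `L =
lam / (s + lam)`, and `L ^ 2` belongs to the gamma law of shape `2`. -/
lemma busyCycleCDF_eq_of_degenerate (hQ : IsQueue P lam (serviceCDF lam rho beta) T S)
    (hlam : 0 < lam) (hrho : 0 < rho) (hbeta : -lam ≤ beta)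
    (hdeg : Real.exp (-rho) * (lam + beta) = lam) {t : ℝ} (ht : 0 ≤ t) :
    busyCycleCDF P T S t = 1 - (1 + beta * t) * Real.exp (-(lam * t)) := by
  have := isProbabilityMeasure_expMeasure hlam
  have := isProbabilityMeasure_gammaMeasure two_pos hlam
  rw [hQ.busyCycleCDF_eq_of_laplace_eq hlam hrho hbeta
    (ae_nonneg_expMeasure lam) (ae_nonneg_gammaMeasure 2 lam) (1 - beta / lam) (fun s hs => ?_) t,
    cdf_expMeasure_eq hlam, if_pos ht, cdf_eq_real, gammaMeasure_two_real_Iic hlam ht]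
  · field_simp
    ring
  · rw [laplace_expMeasure hlam hs, laplace_gammaMeasure two_pos hlam hs, hdeg, Real.rpow_two]
    have h2 : s + lam ≠ 0 := by positivity
    field_simp
    ring

lemma busyCycleCDF_eq (hQ : IsQueue P lam (serviceCDF lam rho beta) T S)
    (hlam : 0 < lam) (hrho : 0 < rho) (hbeta : -lam ≤ beta)
    (hne : lam - Real.exp (-rho) * (lam + beta) ≠ 0) {t : ℝ} (ht : 0 ≤ t) :
    busyCycleCDF P T S t =
      1 - (1 - Real.exp (-rho)) * (lam + beta) / (lam - Real.exp (-rho) * (lam + beta)) *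
            Real.exp (-(Real.exp (-rho) * (lam + beta) * t))
        + beta / (lam - Real.exp (-rho) * (lam + beta)) * Real.exp (-(lam * t)) := by
  rcases hbeta.eq_or_lt with rfl | hlt
  · rw [hQ.busyCycleCDF_eq_exponential hlam hrho, cdf_expMeasure_eq hlam, if_pos ht]
    simp [hlam.ne', sub_eq_add_neg]
  · have hmu : 0 < Real.exp (-rho) * (lam + beta) := mul_pos (Real.exp_pos _) (by linarith)
    rw [hQ.busyCycleCDF_eq_mixture hlam hrho hlt hne, cdf_expMeasure_eq hlam,
      cdf_expMeasure_eq hmu, if_pos ht, if_pos ht]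
    field_simp
    ring

end IsQueue

lemma sub_exp_neg_mul_eq_zero_iff {lam rho beta : ℝ} :
    lam - Real.exp (-rho) * (lam + beta) = 0 ↔ beta = lam * (Real.exp rho - 1) := by
  have h : Real.exp (-rho) * Real.exp rho = 1 := by rw [← Real.exp_add]; simp
  have hpos := Real.exp_pos rho
  constructor
  · intro h1
    linear_combination (-Real.exp rho) * h1 - (lam + beta) * h
  · rintro rfl
    linear_combination (-lam) * h

lemma mixture_weights_nonneg_iff {lam rho beta : ℝ} (hrho : 0 < rho)
    (hbeta : -lam < beta) (hne : lam - Real.exp (-rho) * (lam + beta) ≠ 0) :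
    (0 ≤ (1 - Real.exp (-rho)) * (lam + beta) / (lam - Real.exp (-rho) * (lam + beta)) ∧
      0 ≤ 1 - (1 - Real.exp (-rho)) * (lam + beta) / (lam - Real.exp (-rho) * (lam + beta))) ↔
      beta ≤ 0 := by
  have hq1 : Real.exp (-rho) < 1 := Real.exp_lt_one_iff.2 (by linarith)
  have hnum : 0 < (1 - Real.exp (-rho)) * (lam + beta) := mul_pos (by linarith) (by linarith)
  have h1 : 1 - (1 - Real.exp (-rho)) * (lam + beta) / (lam - Real.exp (-rho) * (lam + beta)) =
      -beta / (lam - Real.exp (-rho) * (lam + beta)) := by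
    field_simp
    ring
  rw [h1]
  rcases lt_or_gt_of_ne hne with hneg | hpos
  -- A negative denominator means `lam < exp (-rho) * (lam + beta) < lam + beta`; the first weight
  -- is then negative as well.
  · have hb : 0 < beta := by nlinarith [Real.exp_pos (-rho)]
    exact ⟨fun h => absurd h.1 (not_le.2 (div_neg_of_pos_of_neg hnum hneg)), fun h => by linarith⟩
  · rw [le_div_iff₀ hpos, le_div_iff₀ hpos, zero_mul]
    exact ⟨fun h => by linarith [h.2], fun h => ⟨hnum.le, by linarith⟩⟩

/-- In the variable `x = exp r` the quotient is the difference quotient at `2` of `(x - 1) exp(-lam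
t / (x - 1))`, whose value there is `exp(-lam t)`; the limit is a derivative. -/
lemma tendsto_busyCycleCDF_log_two (lam t : ℝ) :
    Tendsto (fun r : ℝ =>
        1 - ((Real.exp r - 1) * Real.exp (-(lam / (Real.exp r - 1) * t))
              - Real.exp (-(lam * t))) / (Real.exp r - 2))
      (𝓝[≠] (Real.log 2)) (𝓝 (1 - (1 + lam * t) * Real.exp (-(lam * t)))) := by
  have hexp : Real.exp (Real.log 2) = 2 := Real.exp_log two_pos
  have h1 : HasDerivAt (fun x : ℝ => (x - 1) * Real.exp (-(lam / (x - 1) * t)))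
      ((1 + lam * t) * Real.exp (-(lam * t))) 2 := by
    have hsub : HasDerivAt (fun x : ℝ => x - 1) 1 2 := (hasDerivAt_id 2).sub_const 1
    have hinv : HasDerivAt (fun x : ℝ => -(lam / (x - 1) * t)) (lam * t) 2 := by
      convert! (((hasDerivAt_const (2 : ℝ) lam).div hsub (by norm_num)).mul_const t).neg using 1
      norm_num
    convert! hsub.mul hinv.exp using 1
    norm_num
    ring
  have h2 : Tendsto Real.exp (𝓝[≠] (Real.log 2)) (𝓝[≠] 2) := by
    refine tendsto_nhdsWithin_iff.2 ⟨?_, ?_⟩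
    · have := (Real.continuous_exp.tendsto (Real.log 2)).mono_left
        (nhdsWithin_le_nhds (s := {Real.log 2}ᶜ))
      rwa [hexp] at this
    · filter_upwards [self_mem_nhdsWithin] with r hr h
      exact hr (by rw [← Real.log_exp r, h]; rfl)
  have h3 := ((hasDerivAt_iff_tendsto_slope.1 h1).comp h2).const_sub 1
  refine h3.congr fun r => ?_
  simp only [Function.comp, slope_def_field]
  norm_num

end MGInfinity

end
-- Assembly of the cases.
theorem mainTheorem2 {Ω : Type*} [MeasurableSpace Ω] (P : Measure Ω) [IsProbabilityMeasure P]
    (lam rho beta : ℝ) (hlam : 0 < lam) (hrho : 0 < rho)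
    (hbeta₁ : -lam ≤ beta) (hbeta₂ : beta ≤ lam / (Real.exp rho - 1))
    (T S : ℕ → Ω → ℝ)
    (hQ : MGInfinity.IsQueue P lam (MGInfinity.serviceCDF lam rho beta) T S) :
    -- the busy cycle length is a random variable
    AEMeasurable (MGInfinity.busyCycle T S) P ∧
    -- its distribution function
    (beta ≠ lam * (Real.exp rho - 1) → ∀ t : ℝ, 0 ≤ t →
      MGInfinity.busyCycleCDF P T S t =
        1 - (1 - Real.exp (-rho)) * (lam + beta) / (lam - Real.exp (-rho) * (lam + beta)) *
              Real.exp (-(Real.exp (-rho) * (lam + beta) * t))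
          + beta / (lam - Real.exp (-rho) * (lam + beta)) * Real.exp (-(lam * t))) ∧
    -- the value of `beta` at which the denominators vanish
    (beta = lam * (Real.exp rho - 1) → ∀ t : ℝ, 0 ≤ t →
      MGInfinity.busyCycleCDF P T S t = 1 - (1 + beta * t) * Real.exp (-(lam * t))) ∧
    -- mixture of two exponential distributions, with weights `w` and `1 - w`
    (-lam < beta → beta ≠ lam * (Real.exp rho - 1) →
      ∃ w : ℝ,
        w = (1 - Real.exp (-rho)) * (lam + beta) / (lam - Real.exp (-rho) * (lam + beta)) ∧
        ((0 ≤ w ∧ 0 ≤ 1 - w) ↔ beta ≤ 0) ∧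
        ∀ t : ℝ, MGInfinity.busyCycleCDF P T S t =
          w * cdf (expMeasure (Real.exp (-rho) * (lam + beta))) t
            + (1 - w) * cdf (expMeasure lam) t) ∧
    -- the case `beta = -lam`
    (beta = -lam →
      (∀ t : ℝ, 0 ≤ t → MGInfinity.serviceCDF lam rho beta t = 1) ∧
      (∀ t : ℝ, 0 ≤ t → MGInfinity.busyCycleCDF P T S t = 1 - Real.exp (-(lam * t))) ∧
      ∀ t : ℝ, MGInfinity.busyCycleCDF P T S t = cdf (expMeasure lam) t) ∧
    -- the case `beta = lam / (exp rho - 1)`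
    (beta = lam / (Real.exp rho - 1) → ∀ t : ℝ, 0 ≤ t →
      (rho ≠ Real.log 2 →
        MGInfinity.busyCycleCDF P T S t =
          1 - ((Real.exp rho - 1) * Real.exp (-(lam / (Real.exp rho - 1) * t))
                - Real.exp (-(lam * t))) / (Real.exp rho - 2)) ∧
      (rho = Real.log 2 →
        MGInfinity.busyCycleCDF P T S t = 1 - (1 + lam * t) * Real.exp (-(lam * t)))) ∧
    -- the limit of the last formula as the traffic intensity tends to `log 2`
    (∀ t : ℝ, 0 ≤ t →
      Tendsto (fun r : ℝ =>
          1 - ((Real.exp r - 1) * Real.exp (-(lam / (Real.exp r - 1) * t))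
                - Real.exp (-(lam * t))) / (Real.exp r - 2))
        (𝓝[≠] (Real.log 2)) (𝓝 (1 - (1 + lam * t) * Real.exp (-(lam * t))))) := by
  have hexp1 : 0 < Real.exp rho - 1 := by linarith [Real.add_one_lt_exp hrho.ne']
  have hinv : Real.exp (-rho) = (Real.exp rho)⁻¹ := Real.exp_neg rho
  have hE := Real.exp_pos rho
  refine ⟨hQ.aemeasurable_busyCycle hlam hrho hbeta₁, fun hne t ht => ?_, fun hdeg t ht => ?_,
    fun hlt hne => ⟨_, rfl, ?_, fun t => ?_⟩, ?_, ?_,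
    fun t _ => MGInfinity.tendsto_busyCycleCDF_log_two lam t⟩
  · exact hQ.busyCycleCDF_eq hlam hrho hbeta₁
      (MGInfinity.sub_exp_neg_mul_eq_zero_iff.not.2 hne) ht
  · refine hQ.busyCycleCDF_eq_of_degenerate hlam hrho hbeta₁ ?_ ht
    linarith [MGInfinity.sub_exp_neg_mul_eq_zero_iff.2 hdeg]
  · exact MGInfinity.mixture_weights_nonneg_iff hrho hlt
      (MGInfinity.sub_exp_neg_mul_eq_zero_iff.not.2 hne)
  · exact hQ.busyCycleCDF_eq_mixture hlam hrho hlt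
      (MGInfinity.sub_exp_neg_mul_eq_zero_iff.not.2 hne) t
  · rintro rfl
    have hcdf := hQ.busyCycleCDF_eq_exponential hlam hrho
    refine ⟨fun t ht => ?_, fun t ht => ?_, hcdf⟩
    · simp [MGInfinity.serviceCDF, not_lt.2 ht]
    · rw [hcdf, cdf_expMeasure_eq hlam, if_pos ht]
  · intro hb t ht
    have hsum : lam + beta = lam * Real.exp rho / (Real.exp rho - 1) := by
      rw [hb]; field_simp; ring
    -- At this endpoint the first rate equals `beta` itself, so it coincides with `lam` exactly when
    -- `exp rho = 2`.
    have hmu : Real.exp (-rho) * (lam + beta) = lam / (Real.exp rho - 1) := by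
      rw [hsum, hinv]; field_simp
    refine ⟨fun hne => ?_, fun heq => ?_⟩
    · have h2 : Real.exp rho - 2 ≠ 0 := fun h => hne (by
        rw [← Real.log_exp rho, sub_eq_zero.1 h])
      have hden : lam - lam / (Real.exp rho - 1) =
          lam * (Real.exp rho - 2) / (Real.exp rho - 1) := by
        field_simp; ring
      rw [hQ.busyCycleCDF_eq hlam hrho hbeta₁ ?_ ht]
      · rw [hmu, hden, hsum, hinv, hb]
        field_simp
        ring
      · rw [hmu, hden]
        exact div_ne_zero (mul_ne_zero hlam.ne' h2) hexp1.ne'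
    · have h2 : Real.exp rho = 2 := by rw [heq, Real.exp_log two_pos]
      have hb' : beta = lam := by rw [hb, h2]; norm_num
      rw [hQ.busyCycleCDF_eq_of_degenerate hlam hrho hbeta₁ ?_ ht, hb']
      rw [hmu, h2]; norm_num
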